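/- Let $d\in\mathbb N$. A \emph{copula} is the restriction to $[0,1]^d$ of the distribution function of a random vector in $\mathbb R^d$ whose components are all uniformly distributed on $[0,1]$; the same letter denotes the copula and the corresponding Borel probability measure. A \emph{$D$-norm} is a function of the form $\|x\|_D=E\big(\max_{1\le i\le d}|x_i|Z_i\big)$, $x\in\mathbb R^d$, where $Z_1,\dots,Z_d\ge 0$ are random variables with $E(Z_i)=1$ for all $i$. Let $C$ be a copula on $[0,1]^d$ and let $\|\cdot\|_D$ be a $D$-norm on $\mathbb R^d$ whose partial derivatives up to order $d$ in pairwise distinct variables exist on $(-\infty,0)^d$. For $\{i_1<\dots<i_k\}\subseteq\{1,\dots,d\}$ write $\frac{\partial^k}{\partial x_{i_1}\cdots\partial x_{i_k}}$ for the corresponding mixed partial derivative, the derivative with respect to $x_{i_k}$ being taken first; only these derivatives are required to exist. Assume that (i) $C(u)=1-\|\mathbf 1-u\|_D+o(\|\mathbf 1-u\|)$ as $u\to\mathbf 1=(1,\dots,1)$, $u\in[0,1]^d$; (ii) for every nonempty $\{i_1<\dots<i_k\}\subseteq\{1,\dots,d\}$ and every $x\in(-\infty,0)^d$, $$\frac{\partial^k}{\partial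 x_{i_1}\cdots\partial x_{i_k}}\,n\Big(C\big(\mathbf 1+\tfrac{x}{n}\big)-1\Big)\ \longrightarrow\ -\frac{\partial^k}{\partial x_{i_1}\cdots\partial x_{i_k}}\,\|x\|_D\qquad(n\to\infty);$$ (iii) $C$ has continuous partial derivatives of all orders up to $d$ on $(0,1)^d$. For $n\ge 1$ and $u\in[0,1]^d$ put $C^{(n)}(u)=\big(C(u_1^{1/n},\dots,u_d^{1/n})\big)^n$ and $C_G(u)=\exp\big(-\|(\log u_1,\dots,\log u_d)\|_D\big)$, where $C_G(u)=0$ if some $u_i=0$. Then $C^{(n)}$, $n\ge1$, and $C_G$ are copulas, and $$\sup_{A}\big|C^{(n)}(A)-C_G(A)\big|\ \longrightarrow\ 0\qquad(n\to\infty),$$ where the supremum is taken over all Borel sets $A\subseteq[0,1]^d$. -/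

import Mathlib

open MeasureTheory Filter Topology Asymptotics

noncomputable section

/-- The probability measure `μ` on `ℝ^d` has distribution function `F` on the unit cube. -/
def HasCubeCDF {d : ℕ} (μ : Measure (Fin d → ℝ)) (F : (Fin d → ℝ) → ℝ) : Prop :=
  IsProbabilityMeasure μ ∧ ∀ u ∈ Set.Icc (0 : Fin d → ℝ) 1, μ.real (Set.Iic u) = F u

/-- `C` is, on `[0,1]^d`, a copula: the distribution function of a random vector all of whose
components are uniformly distributed on `[0,1]`. Values of `C` off the cube are irrelevant. -/
def IsCopula {d : ℕ} (C : (Fin d → ℝ) → ℝ) : Prop :=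
  ∃ μ : Measure (Fin d → ℝ), HasCubeCDF μ C ∧
    ∀ i : Fin d, ∀ t ∈ Set.Icc (0 : ℝ) 1, μ.real {u | u i ≤ t} = t

/-- `N` is a `D`-norm: `N x = E (max_i |x_i| Z_i)` for a random vector `Z` with nonnegative
components of expectation one. The measure `ζ` is the law of `Z`. -/
def IsDNorm {d : ℕ} (N : (Fin d → ℝ) → ℝ) : Prop :=
  ∃ ζ : Measure (Fin d → ℝ), IsProbabilityMeasure ζ ∧
    (∀ i, ∀ᵐ z ∂ζ, 0 ≤ z i) ∧
    (∀ i, Integrable (fun z : Fin d → ℝ => z i) ζ ∧ ∫ z, z i ∂ζ = 1) ∧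
    ∀ x, N x = ∫ z, (⨆ i, |x i| * z i) ∂ζ

/-- The partial derivative `∂f/∂x_i`. -/
def partialDeriv {d : ℕ} (i : Fin d) (f : (Fin d → ℝ) → ℝ) : (Fin d → ℝ) → ℝ :=
  fun x => lineDeriv ℝ f x (Pi.single i 1)

/-- The mixed partial derivative `∂^k f/∂x_{i_1}⋯∂x_{i_k}`, where `i_1 < ⋯ < i_k` are the
elements of the block `B`; the derivative in `x_{i_k}` is taken first. -/
def mixedPartial {d : ℕ} (B : Finset (Fin d)) (f : (Fin d → ℝ) → ℝ) : (Fin d → ℝ) → ℝ :=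
  (B.sort (· ≤ ·)).foldr partialDeriv f

/-- On the set `U`, all mixed partial derivatives `mixedPartial B f` exist: each of the successive
derivatives in the definition of `mixedPartial` is a genuine one at every point of `U`. -/
def HasMixedPartialsOn {d : ℕ} (f : (Fin d → ℝ) → ℝ) (U : Set (Fin d → ℝ)) : Prop :=
  ∀ (i : Fin d) (B : Finset (Fin d)), (∀ j ∈ B, i < j) →
    ∀ x ∈ U, LineDifferentiableAt ℝ (mixedPartial B f) x (Pi.single i 1)

/-- The expansion `C(u) = 1 - N(1 - u) + o(‖1 - u‖)` as `u → 1` within `[0,1]^d`. -/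
def HasDNormExpansion {d : ℕ} (C N : (Fin d → ℝ) → ℝ) : Prop :=
  (fun u => C u - (1 - N (1 - u))) =o[𝓝[Set.Icc (0 : Fin d → ℝ) 1] 1]
    (fun u : Fin d → ℝ => 1 - u)

/-- The convergence, for every nonempty block `B` and every `x < 0` (componentwise), of the mixed
partial derivatives of `n (C(1 + x/n) - 1)` to those of `-N(x)`. -/
def MixedPartialsConverge {d : ℕ} (C N : (Fin d → ℝ) → ℝ) : Prop :=
  ∀ B : Finset (Fin d), B.Nonempty → ∀ x : Fin d → ℝ, (∀ i, x i < 0) →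
    Tendsto
      (fun n : ℕ => mixedPartial B (fun y => (n : ℝ) * (C (fun i => 1 + y i / n) - 1)) x)
      atTop (𝓝 (mixedPartial B (fun y => -N y) x))

/-- The copula `C^{(n)}(u) = C^n(u^{1/n})` of the vector of componentwise maxima. -/
def maxCopula {d : ℕ} (C : (Fin d → ℝ) → ℝ) (n : ℕ) : (Fin d → ℝ) → ℝ :=
  fun u => C (fun i => u i ^ ((1 : ℝ) / n)) ^ n

open Classical in
/-- The function `C_G(u) = exp(-N(log u_1, …, log u_d))` on `[0,1]^d`, with the usual convention
`log 0 = -∞`, that is, `C_G(u) = 0` if some component of `u` is zero. -/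
def extremeValueCopula {d : ℕ} (N : (Fin d → ℝ) → ℝ) : (Fin d → ℝ) → ℝ :=
  fun u => if ∃ i, u i = 0 then 0 else Real.exp (-N (fun i => Real.log (u i)))

/-- The total variation distance on `[0,1]^d`: the supremum of `|μ(A) - ν(A)|` over all Borel
sets `A ⊆ [0,1]^d`. -/
def tvDistCube {d : ℕ} (μ ν : Measure (Fin d → ℝ)) : ℝ :=
  ⨆ A : {A : Set (Fin d → ℝ) // MeasurableSet A ∧ A ⊆ Set.Icc 0 1}, |μ.real A.1 - ν.real A.1|

end

/-! ### Iterated differences, their derivatives and their recovery by integration. -/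

section BoxDifferences

variable {d : ℕ}

/-! The proof shows L¹ convergence of densities, in coordinates adapted to hypothesis (ii). Let U
have law C^{(n)}, X = log U, and Y = T_n(X) with T_n = `expScale n`, that is Y_i = n(exp(X_i/n) -
1). Then Y has distribution function (1 + g_n/n)^n on (-n,0)^d, where g_n(y) = n(C(1 + y/n) - 1),
and g_n tends to -N pointwise by (i) and the homogeneity of N.

Densities. A distribution function has nonnegative box differences. This passes to partial
derivatives and to pointwise limits. Nonnegativity makes the successive derivatives integrable even
when they are not continuous, so the fundamental theorem of calculus, one coordinate at a time,
identifies the full mixed derivative as the density (`restrict_eq_withDensity_partialDensity`).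
Applied to the limit exp(-N), which vanishes at -∞ because |x_i| ≤ N x, the same argument produces a
probability measure with that distribution function; hence C_G is a copula
(`isCopula_extremeValueCopula`).

Convergence. By a formal Faà di Bruno expansion, the full mixed derivative f_n of (1 + g_n/n)^n is a
fixed polynomial in the derivatives of t ↦ (1 + t/n)^n at g_n and the mixed partials of g_n. Both
converge, so f_n tends pointwise to the density h of the limit (`tendsto_partialDensity`), and
Scheffé's lemma gives convergence in L¹.

Return to X. Hypothesis (ii) gives no uniformity in x, so the convergence cannot be evaluated at the
moving point T_n x. Instead, with J_n the Jacobian, X has density J_n · (f_n ∘ T_n), whose L¹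
distance to h is at most ‖f_n - h‖₁ + ‖J_n · (h ∘ T_n) - h‖₁. The last term vanishes by
approximating h by continuous functions of compact support. Taking logarithms does not change total
variation, since copulas do not charge the boundary of the cube. -/

/-- The cube `I^d`. -/
def cubeOf (d : ℕ) (I : Set ℝ) : Set (Fin d → ℝ) := {x | ∀ i, x i ∈ I}

/-- The iterated difference of `F` between `a` and `b` in the coordinates listed in `L`. -/
def boxDiff (a b : Fin d → ℝ) (L : List (Fin d)) (F : (Fin d → ℝ) → ℝ) : (Fin d → ℝ) → ℝ :=
  L.foldr (fun i K x => K (Function.update x i (b i)) - K (Function.update x i (a i))) F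

/-- All iterated differences of `F` in coordinates belonging to `S` are nonnegative. -/
def BoxIncreasing (I : Set ℝ) (S : Finset (Fin d)) (F : (Fin d → ℝ) → ℝ) : Prop :=
  ∀ L : List (Fin d), L.Nodup → (∀ i ∈ L, i ∈ S) → ∀ a ∈ cubeOf d I, ∀ b ∈ cubeOf d I,
    (∀ i, a i ≤ b i) → ∀ x ∈ cubeOf d I, 0 ≤ boxDiff a b L F x

theorem boxDiff_cons (a b : Fin d → ℝ) (j : Fin d) (L : List (Fin d)) (F : (Fin d → ℝ) → ℝ)
    (x : Fin d → ℝ) : boxDiff a b (j :: L) F x =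
      boxDiff a b L F (Function.update x j (b j)) - boxDiff a b L F (Function.update x j (a j)) :=
  rfl

theorem update_mem_cubeOf {I : Set ℝ} {x : Fin d → ℝ} (hx : x ∈ cubeOf d I) (i : Fin d) {t : ℝ}
    (ht : t ∈ I) : Function.update x i t ∈ cubeOf d I := by
  intro k
  by_cases h : k = i
  · subst h; simpa using ht
  · simpa [h] using hx k

theorem isOpen_cubeOf {I : Set ℝ} (hI : IsOpen I) : IsOpen (cubeOf d I) := by
  have : cubeOf d I = Set.univ.pi fun _ => I := by ext; simp [cubeOf]
  rw [this]
  exact isOpen_set_pi Set.finite_univ fun _ _ => hI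

theorem add_smul_single (x : Fin d → ℝ) (j : Fin d) (t : ℝ) :
    x + t • Pi.single j (1 : ℝ) = Function.update x j (x j + t) := by
  ext k
  by_cases h : k = j
  · subst h; simp
  · simp [h]

theorem update_add_smul_single {i j : Fin d} (h : i ≠ j) (x : Fin d → ℝ) (c t : ℝ) :
    Function.update (x + t • Pi.single j (1 : ℝ)) i c =
      Function.update x i c + t • Pi.single j (1 : ℝ) := by
  rw [add_smul_single, add_smul_single, Function.update_of_ne h.symm, Function.update_comm h]

theorem tendsto_boxDiff {I : Set ℝ} {ι : Type*} {l : Filter ι} {H : ι → (Fin d → ℝ) → ℝ}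
    {F : (Fin d → ℝ) → ℝ} (h : ∀ x ∈ cubeOf d I, Tendsto (fun n => H n x) l (𝓝 (F x)))
    {a b : Fin d → ℝ} (ha : a ∈ cubeOf d I) (hb : b ∈ cubeOf d I) (L : List (Fin d)) :
    ∀ x ∈ cubeOf d I, Tendsto (fun n => boxDiff a b L (H n) x) l (𝓝 (boxDiff a b L F x)) := by
  induction L with
  | nil => exact h
  | cons j L ih =>
    intro x hx
    exact (ih _ (update_mem_cubeOf hx j (hb j))).sub (ih _ (update_mem_cubeOf hx j (ha j)))

theorem boxDiff_congr_bounds {a b a' b' : Fin d → ℝ} (L : List (Fin d))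
    (h : ∀ i ∈ L, a i = a' i ∧ b i = b' i) (F : (Fin d → ℝ) → ℝ) :
    boxDiff a b L F = boxDiff a' b' L F := by
  induction L with
  | nil => rfl
  | cons j L ih =>
    funext x
    rw [boxDiff_cons, boxDiff_cons, ih fun i hi => h i (by simp [hi]), (h j (by simp)).1,
      (h j (by simp)).2]

theorem hasLineDerivAt_boxDiff {I : Set ℝ} {F F' : (Fin d → ℝ) → ℝ} {j : Fin d}
    (h : ∀ x ∈ cubeOf d I, HasLineDerivAt ℝ F (F' x) x (Pi.single j 1))
    {a b : Fin d → ℝ} (ha : a ∈ cubeOf d I) (hb : b ∈ cubeOf d I) (L : List (Fin d))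
    (hj : j ∉ L) :
    ∀ x ∈ cubeOf d I, HasLineDerivAt ℝ (boxDiff a b L F) (boxDiff a b L F' x) x
      (Pi.single j 1) := by
  induction L with
  | nil => exact h
  | cons i L ih =>
    intro x hx
    have hij : i ≠ j := fun e => hj (by simp [e])
    have ih' := ih fun e => hj (by simp [e])
    have h1 := ih' _ (update_mem_cubeOf hx i (hb i))
    have h2 := ih' _ (update_mem_cubeOf hx i (ha i))
    unfold HasLineDerivAt at *
    simp only [boxDiff_cons, update_add_smul_single hij]
    exact h1.sub h2

/-- A difference quotient in direction j of an iterated difference is again an iterated difference,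
with j added, divided by a positive number. The limit is taken from the right so that the added edge
is correctly oriented. This uses up the coordinate j. -/
theorem BoxIncreasing.deriv {I : Set ℝ} (hI : IsOpen I) {S : Finset (Fin d)} {j : Fin d}
    {F F' : (Fin d → ℝ) → ℝ} (hF : BoxIncreasing I S F) (hj : j ∈ S)
    (h : ∀ x ∈ cubeOf d I, HasLineDerivAt ℝ F (F' x) x (Pi.single j 1)) :
    BoxIncreasing I (S.erase j) F' := by
  intro L hL hLS a ha b hb hab x hx
  have hjL : j ∉ L := fun e => by simpa using hLS j e
  refine ge_of_tendsto (hasLineDerivAt_boxDiff h ha hb L hjL x hx).tendsto_slope_zero_right ?_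
  have hcont : ∀ᶠ t in 𝓝[>] (0 : ℝ), x j + t ∈ I := by
    have : Tendsto (fun t : ℝ => x j + t) (𝓝[>] 0) (𝓝 (x j)) := by
      have : Continuous fun t : ℝ => x j + t := by fun_prop
      simpa using (this.tendsto 0).mono_left nhdsWithin_le_nhds
    exact this (hI.mem_nhds (hx j))
  filter_upwards [hcont, self_mem_nhdsWithin] with t ht ht0
  have ht0 : 0 < t := ht0
  -- The added edge of the box runs from x j to x j + t.
  have key := hF (j :: L) (List.nodup_cons.2 ⟨hjL, hL⟩)
    (fun i hi => by
      rcases List.mem_cons.1 hi with rfl | hi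
      · exact hj
      · exact Finset.mem_of_mem_erase (hLS i hi))
    _ (update_mem_cubeOf ha j (hx j)) _ (update_mem_cubeOf hb j ht)
    (fun i => by
      by_cases e : i = j
      · subst e; simpa using ht0.le
      · simpa [e] using hab i) x hx
  rw [boxDiff_cons, ← boxDiff_congr_bounds (a := a) (b := b) L] at key
  · rw [add_smul_single]
    simp only [Function.update_self, Function.update_eq_self] at key
    exact smul_nonneg (inv_nonneg.2 ht0.le) key
  · intro i hi
    have : i ≠ j := fun e => hjL (e ▸ hi)
    simp [this]

/-- The successive derivatives of `F` in the order prescribed by `L` (last element first) exist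
on `U`. -/
def HasPartialsAlong (F : (Fin d → ℝ) → ℝ) (U : Set (Fin d → ℝ)) (L : List (Fin d)) : Prop :=
  ∀ (j : Fin d) (L' : List (Fin d)), j :: L' <:+ L →
    ∀ x ∈ U, LineDifferentiableAt ℝ (L'.foldr partialDeriv F) x (Pi.single j 1)

theorem HasPartialsAlong.tail {F : (Fin d → ℝ) → ℝ} {U : Set (Fin d → ℝ)} {j : Fin d}
    {L : List (Fin d)} (h : HasPartialsAlong F U (j :: L)) : HasPartialsAlong F U L :=
  fun i L' hL' => h i L' (hL'.trans (List.suffix_cons j L))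

theorem HasPartialsAlong.hasLineDerivAt {F : (Fin d → ℝ) → ℝ} {U : Set (Fin d → ℝ)} {j : Fin d}
    {L : List (Fin d)} (h : HasPartialsAlong F U (j :: L)) {x : Fin d → ℝ} (hx : x ∈ U) :
    HasLineDerivAt ℝ (L.foldr partialDeriv F) ((j :: L).foldr partialDeriv F x) x
      (Pi.single j 1) :=
  (h j L (List.suffix_refl _) x hx).hasLineDerivAt

/-- Applied with the empty list of differences, this says that every successive derivative is
nonnegative, as integration requires. -/
theorem BoxIncreasing.foldr_partialDeriv {I : Set ℝ} (hI : IsOpen I) {F : (Fin d → ℝ) → ℝ}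
    (hF : BoxIncreasing I Finset.univ F) (L : List (Fin d)) (hL : L.Nodup)
    (h : HasPartialsAlong F (cubeOf d I) L) :
    BoxIncreasing I (Finset.univ \ L.toFinset) (L.foldr partialDeriv F) := by
  induction L with
  | nil => simpa using hF
  | cons j L ih =>
    have hjL := (List.nodup_cons.1 hL).1
    have := (ih (List.nodup_cons.1 hL).2 h.tail).deriv hI (j := j) (by simpa using hjL)
      (fun x hx => h.hasLineDerivAt hx)
    convert this using 1
    ext i
    simp only [List.toFinset_cons, Finset.mem_sdiff, Finset.mem_univ, Finset.mem_insert,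
      Finset.mem_erase]
    tauto

/-- The derivatives need not be continuous; they are measurable as pointwise limits of difference
quotients with increments 1/(n+1). Since the cube is open, the shifted point eventually lies in it,
so extension by zero does no harm. -/
theorem measurable_indicator_foldr_partialDeriv {I : Set ℝ} (hI : IsOpen I)
    {F : (Fin d → ℝ) → ℝ} (hF : Measurable ((cubeOf d I).indicator F)) (L : List (Fin d))
    (h : HasPartialsAlong F (cubeOf d I) L) :
    Measurable ((cubeOf d I).indicator (L.foldr partialDeriv F)) := by
  induction L with
  | nil => simpa using hF
  | cons j L ih =>
    have ih := ih h.tail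
    have hU : IsOpen (cubeOf d I) := isOpen_cubeOf hI
    set U := cubeOf d I
    set K := L.foldr partialDeriv F
    refine measurable_of_tendsto_metrizable (f := fun (n : ℕ) => U.indicator fun x =>
      ((1 : ℝ) / (n + 1))⁻¹ *
        (U.indicator K (x + ((1 : ℝ) / (n + 1)) • Pi.single j 1) - U.indicator K x))
      (fun n => ?_) ?_
    · refine Measurable.indicator ?_ hU.measurableSet
      exact ((ih.comp (measurable_id.add_const _)).sub ih).const_mul _
    · rw [tendsto_pi_nhds]
      intro x
      by_cases hx : x ∈ U
      · simp only [Set.indicator_of_mem hx]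
        have h1 := (h.hasLineDerivAt hx).tendsto_slope_zero_right
        have h2 : Tendsto (fun n : ℕ => (1 : ℝ) / (n + 1)) atTop (𝓝[>] 0) :=
          tendsto_nhdsWithin_iff.2 ⟨tendsto_one_div_add_atTop_nhds_zero_nat,
            Eventually.of_forall fun n => by simp only [Set.mem_Ioi]; positivity⟩
        refine (h1.comp h2).congr' ?_
        have h3 : Tendsto (fun n : ℕ => x + ((1 : ℝ) / (n + 1)) • Pi.single j (1 : ℝ)) atTop
            (𝓝 x) := by
          have : Continuous fun t : ℝ => x + t • (Pi.single j (1 : ℝ) : Fin d → ℝ) := by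
            fun_prop
          have h0 := (this.tendsto 0).comp (tendsto_one_div_add_atTop_nhds_zero_nat (𝕜 := ℝ))
          rwa [zero_smul, add_zero] at h0
        filter_upwards [h3.eventually (hU.mem_nhds hx)] with n hn
        rw [Set.indicator_of_mem (show x + ((1 : ℝ) / (n + 1)) • Pi.single j (1 : ℝ) ∈ U from hn)]
        rfl
      · simp [Set.indicator_of_notMem hx]

/-- The fundamental theorem of calculus on a line parallel to axis j. Integrability of K' is
automatic because a nonnegative derivative is integrable. If another coordinate of x leaves I, all
three terms vanish, so the identity holds for every x and can be integrated over the other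
coordinates. -/
theorem ofReal_indicator_update_eq_add_lintegral {I : Set ℝ} (hI' : I.OrdConnected) {K K' : (Fin d → ℝ) → ℝ} {j : Fin d}
    (h : ∀ x ∈ cubeOf d I, HasLineDerivAt ℝ K (K' x) x (Pi.single j 1))
    (hK : ∀ x ∈ cubeOf d I, 0 ≤ K x) (hK' : ∀ x ∈ cubeOf d I, 0 ≤ K' x)
    {a b : ℝ} (ha : a ∈ I) (hb : b ∈ I) (hab : a ≤ b) (x : Fin d → ℝ) :
    ENNReal.ofReal ((cubeOf d I).indicator K (Function.update x j b)) =
      ENNReal.ofReal ((cubeOf d I).indicator K (Function.update x j a)) +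
      ∫⁻ t in Set.Ioc a b, ENNReal.ofReal ((cubeOf d I).indicator K' (Function.update x j t)) := by
  by_cases hx : ∀ i, i ≠ j → x i ∈ I
  · have hmem : ∀ t ∈ I, Function.update x j t ∈ cubeOf d I := by
      intro t ht i
      by_cases e : i = j
      · subst e; simpa using ht
      · simpa [e] using hx i e
    have hsub : Set.Icc a b ⊆ I := hI'.out ha hb
    have hder : ∀ t ∈ Set.Icc a b, HasDerivAt (fun t => K (Function.update x j t))
        (K' (Function.update x j t)) t := by
      intro t ht
      have h1 : HasDerivAt (fun s => K (Function.update x j t + s • Pi.single j (1 : ℝ)))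
          (K' (Function.update x j t)) (t - t) := by
        rw [sub_self]
        exact h _ (hmem t (hsub ht))
      have := h1.comp_sub_const t t
      simpa [add_smul_single] using this
    have hcont : ContinuousOn (fun t => K (Function.update x j t)) (Set.Icc a b) :=
      fun t ht => (hder t ht).continuousAt.continuousWithinAt
    have hint : IntegrableOn (fun t => K' (Function.update x j t)) (Set.Ioc a b) :=
      intervalIntegral.integrableOn_deriv_of_nonneg hcont
        (fun t ht => hder t (Set.Ioo_subset_Icc_self ht))
        (fun t ht => hK' _ (hmem t (hsub (Set.Ioo_subset_Icc_self ht))))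
    have hftc := intervalIntegral.integral_eq_sub_of_hasDerivAt
      (by rw [Set.uIcc_of_le hab]; exact hder)
      ((intervalIntegrable_iff_integrableOn_Ioc_of_le hab).2 hint)
    rw [intervalIntegral.integral_of_le hab] at hftc
    have hl : ∫⁻ t in Set.Ioc a b, ENNReal.ofReal
          ((cubeOf d I).indicator K' (Function.update x j t)) =
        ∫⁻ t in Set.Ioc a b, ENNReal.ofReal (K' (Function.update x j t)) := by
      refine setLIntegral_congr_fun measurableSet_Ioc fun t ht => ?_
      simp only [Set.indicator_of_mem (hmem t (hsub (Set.Ioc_subset_Icc_self ht)))]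
    rw [hl, ← ofReal_integral_eq_lintegral_ofReal hint, hftc,
      Set.indicator_of_mem (hmem b hb), Set.indicator_of_mem (hmem a ha), ← ENNReal.ofReal_add]
    · congr 1; ring
    · exact hK _ (hmem a ha)
    · rw [← hftc]
      exact setIntegral_nonneg measurableSet_Ioc
        fun t ht => hK' _ (hmem t (hsub (Set.Ioc_subset_Icc_self ht)))
    · exact (ae_restrict_iff' measurableSet_Ioc).2 (Eventually.of_forall
        fun t ht => hK' _ (hmem t (hsub (Set.Ioc_subset_Icc_self ht))))
  · have hnot : ∀ t, Function.update x j t ∉ cubeOf d I := by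
      intro t ht
      refine hx fun i hi => ?_
      simpa [hi] using ht i
    simp [Set.indicator_of_notMem (hnot _)]

/-- A box-increasing function with successive partial derivatives is recovered from the last one
by integration. -/
theorem ofReal_boxDiff_eq_lmarginal {I : Set ℝ} (hI : IsOpen I) (hI' : I.OrdConnected)
    {F : (Fin d → ℝ) → ℝ} (hF : BoxIncreasing I Finset.univ F)
    (hFm : Measurable ((cubeOf d I).indicator F)) {a b : Fin d → ℝ} (ha : a ∈ cubeOf d I)
    (hb : b ∈ cubeOf d I) (hab : ∀ i, a i ≤ b i) (L : List (Fin d)) (hL : L.Nodup)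
    (h : HasPartialsAlong F (cubeOf d I) L) :
    ∀ z ∈ cubeOf d I, ENNReal.ofReal (boxDiff a b L F z) =
      lmarginal (fun i => (volume : Measure ℝ).restrict (Set.Ioc (a i) (b i))) L.toFinset
        (fun x => ENNReal.ofReal ((cubeOf d I).indicator (L.foldr partialDeriv F) x)) z := by
  induction L with
  | nil =>
    intro z hz
    simp [boxDiff, Set.indicator_of_mem hz]
  | cons j L ih =>
    intro z hz
    have hjL := (List.nodup_cons.1 hL).1
    have hL' := (List.nodup_cons.1 hL).2
    have ih := ih hL' h.tail
    have hpos : ∀ M : List (Fin d), M.Nodup → HasPartialsAlong F (cubeOf d I) M →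
        ∀ x ∈ cubeOf d I, 0 ≤ M.foldr partialDeriv F x := fun M hM hM' x hx =>
      hF.foldr_partialDeriv hI M hM hM' [] List.nodup_nil (by simp) a ha b hb hab x hx
    have hmL := measurable_indicator_foldr_partialDeriv hI hFm L h.tail
    have hmj := measurable_indicator_foldr_partialDeriv hI hFm (j :: L) h
    have hjL' : j ∉ L.toFinset := by simpa using hjL
    have e1 := ih _ (update_mem_cubeOf hz j (hb j))
    have e2 := ih _ (update_mem_cubeOf hz j (ha j))
    rw [lmarginal_update_of_notMem hmL.ennreal_ofReal hjL'] at e1 e2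
    -- The integrand on the upper face x_j = b_j is that on the lower face plus the integral of its
    -- j-th derivative along the edge between them.
    have hcomp : (fun x => ENNReal.ofReal ((cubeOf d I).indicator (L.foldr partialDeriv F) x)) ∘
        (Function.update · j (b j)) = fun x =>
        ENNReal.ofReal ((cubeOf d I).indicator (L.foldr partialDeriv F)
          (Function.update x j (a j))) +
        ∫⁻ t in Set.Ioc (a j) (b j), ENNReal.ofReal
          ((cubeOf d I).indicator ((j :: L).foldr partialDeriv F) (Function.update x j t)) := by
      funext x
      exact ofReal_indicator_update_eq_add_lintegral hI'
        (fun x hx => h.hasLineDerivAt hx) (hpos L hL' h.tail) (hpos (j :: L) hL h)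
        (ha j) (hb j) (hab j) x
    rw [hcomp] at e1
    change _ = lmarginal _ _ (fun x => ENNReal.ofReal ((cubeOf d I).indicator
      (L.foldr partialDeriv F) (Function.update x j (a j)))) z at e2
    have hadd : ∀ f g : (Fin d → ℝ) → ENNReal, Measurable f →
        lmarginal (fun i => (volume : Measure ℝ).restrict (Set.Ioc (a i) (b i))) L.toFinset
          (fun x => f x + g x) z =
        lmarginal (fun i => (volume : Measure ℝ).restrict (Set.Ioc (a i) (b i))) L.toFinset f z +
        lmarginal (fun i => (volume : Measure ℝ).restrict (Set.Ioc (a i) (b i))) L.toFinset g z :=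
      fun f g hf => lintegral_add_left (hf.comp measurable_updateFinset) _
    rw [hadd (fun x => ENNReal.ofReal ((cubeOf d I).indicator (L.foldr partialDeriv F)
      (Function.update x j (a j)))) _ (hmL.ennreal_ofReal.comp measurable_update_left)] at e1
    have hsplit : ENNReal.ofReal (boxDiff a b L F (Function.update z j (b j))) =
        ENNReal.ofReal (boxDiff a b L F (Function.update z j (a j))) +
        ENNReal.ofReal (boxDiff a b (j :: L) F z) := by
      rw [← ENNReal.ofReal_add]
      · rw [boxDiff_cons]; congr 1; ring
      · exact hF L hL' (by simp) a ha b hb hab _ (update_mem_cubeOf hz j (ha j))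
      · exact hF (j :: L) hL (by simp) a ha b hb hab _ hz
    rw [hsplit, e2] at e1
    rw [List.toFinset_cons, lmarginal_insert' _ hmj.ennreal_ofReal hjL']
    -- The lower-face term is common to both sides and finite, being `ofReal` of a real number.
    refine (ENNReal.add_right_inj ?_).1 e1
    exact ne_of_eq_of_ne e2.symm ENNReal.ofReal_ne_top

end BoxDifferences

/-! ### Measures with density the full mixed derivative. -/

section Densities

variable {d : ℕ}

theorem boxDiff_congr {I : Set ℝ} {F F' : (Fin d → ℝ) → ℝ} (h : ∀ x ∈ cubeOf d I, F x = F' x)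
    {a b : Fin d → ℝ} (ha : a ∈ cubeOf d I) (hb : b ∈ cubeOf d I) (L : List (Fin d)) :
    ∀ x ∈ cubeOf d I, boxDiff a b L F x = boxDiff a b L F' x := by
  induction L with
  | nil => exact h
  | cons j L ih =>
    intro x hx
    rw [boxDiff_cons, boxDiff_cons, ih _ (update_mem_cubeOf hx j (hb j)),
      ih _ (update_mem_cubeOf hx j (ha j))]

/-- Each difference removes {u_j ≤ a_j} from {u_j ≤ b_j} and so turns one half-line factor into a
half-open interval. -/
theorem boxDiff_measureReal_Iic (μ : Measure (Fin d → ℝ)) [IsFiniteMeasure μ] {a b : Fin d → ℝ}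
    (hab : ∀ i, a i ≤ b i) (L : List (Fin d)) (hL : L.Nodup) (z : Fin d → ℝ) :
    boxDiff a b L (fun x => μ.real (Set.Iic x)) z =
      μ.real (Set.univ.pi fun i => if i ∈ L then Set.Ioc (a i) (b i) else Set.Iic (z i)) := by
  induction L generalizing z with
  | nil => simp [boxDiff, Set.pi_univ_Iic]
  | cons j L ih =>
    have hjL := (List.nodup_cons.1 hL).1
    rw [boxDiff_cons, ih (List.nodup_cons.1 hL).2, ih (List.nodup_cons.1 hL).2,
      ← measureReal_sdiff]
    · congr 1
      ext u
      simp only [Set.mem_sdiff, Set.mem_pi, Set.mem_univ, true_imp_iff]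
      constructor
      · rintro ⟨h1, h2⟩ i
        by_cases hij : i = j
        · subst hij
          have h1i := h1 i
          simp only [hjL, if_false, Function.update_self, Set.mem_Iic] at h1i
          simp only [List.mem_cons, true_or, if_true, Set.mem_Ioc]
          refine ⟨lt_of_not_ge fun hle => h2 fun k => ?_, h1i⟩
          by_cases hk : k = i
          · subst hk; simpa [hjL] using hle
          · simpa [hk] using h1 k
        · simpa [hij] using h1 i
      · intro h
        refine ⟨fun i => ?_, fun h2 => ?_⟩
        · by_cases hij : i = j
          · subst hij
            simpa [hjL] using (show u i ∈ Set.Ioc (a i) (b i) by simpa using h i).2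
          · simpa [hij] using h i
        · have h1 := h j
          have h3 := h2 j
          simp only [List.mem_cons, true_or, if_true, Set.mem_Ioc] at h1
          simp only [hjL, if_false, Function.update_self, Set.mem_Iic] at h3
          exact absurd h1.1 (not_lt.2 h3)
    · intro u hu i hi
      have := hu i hi
      by_cases hij : i = j
      · subst hij
        simp only [hjL, if_false, Function.update_self, Set.mem_Iic] at this ⊢
        exact this.trans (hab i)
      · simpa [hij] using this
    · refine MeasurableSet.univ_pi fun i => ?_
      split_ifs
      · exact measurableSet_Ioc
      · exact measurableSet_Iic

theorem boxIncreasing_of_cdf (μ : Measure (Fin d → ℝ)) [IsFiniteMeasure μ] {I : Set ℝ}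
    {F : (Fin d → ℝ) → ℝ} (h : ∀ x ∈ cubeOf d I, F x = μ.real (Set.Iic x))
    (S : Finset (Fin d)) : BoxIncreasing I S F := by
  intro L hL _ a ha b hb hab x hx
  rw [boxDiff_congr h ha hb L x hx, boxDiff_measureReal_Iic μ hab L hL]
  exact measureReal_nonneg

theorem pi_Ioc_subset_cubeOf {I : Set ℝ} (hI' : I.OrdConnected) {a b : Fin d → ℝ}
    (ha : a ∈ cubeOf d I) (hb : b ∈ cubeOf d I) :
    (Set.univ.pi fun i => Set.Ioc (a i) (b i)) ⊆ cubeOf d I :=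
  fun _ hx i => hI'.out (ha i) (hb i) (Set.Ioc_subset_Icc_self (hx i (Set.mem_univ i)))

/-- The open cube is a countable union of boxes with rational corners inside it; on each of these
the half-open boxes form a π-system generating the Borel sets, and the measures are finite there. -/
theorem restrict_cubeOf_congr {I : Set ℝ} (hI : IsOpen I) (hI' : I.OrdConnected)
    {μ ν : Measure (Fin d → ℝ)}
    (h : ∀ a ∈ cubeOf d I, ∀ b ∈ cubeOf d I, (∀ i, a i ≤ b i) →
      μ (Set.univ.pi fun i => Set.Ioc (a i) (b i)) = ν (Set.univ.pi fun i => Set.Ioc (a i) (b i)))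
    (hfin : ∀ a ∈ cubeOf d I, ∀ b ∈ cubeOf d I,
      μ (Set.univ.pi fun i => Set.Ioc (a i) (b i)) ≠ ⊤) :
    μ.restrict (cubeOf d I) = ν.restrict (cubeOf d I) := by
  let T := {p : (Fin d → ℚ) × (Fin d → ℚ) //
    (fun i => (p.1 i : ℝ)) ∈ cubeOf d I ∧ (fun i => (p.2 i : ℝ)) ∈ cubeOf d I ∧
      ∀ i, (p.1 i : ℝ) ≤ p.2 i}
  have hcover : cubeOf d I =
      ⋃ p : T, Set.univ.pi fun i => Set.Ioc (p.1.1 i : ℝ) (p.1.2 i) := by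
    refine Set.Subset.antisymm (fun x hx => ?_)
      (Set.iUnion_subset fun p => pi_Ioc_subset_cubeOf hI' p.2.1 p.2.2.1)
    have : ∀ i, ∃ q : ℚ × ℚ, (q.1 : ℝ) ∈ I ∧ (q.2 : ℝ) ∈ I ∧ (q.1 : ℝ) < x i ∧ x i < q.2 := by
      intro i
      obtain ⟨l, u, ⟨hl, hu⟩, hlu⟩ := mem_nhds_iff_exists_Ioo_subset.1 (hI.mem_nhds (hx i))
      obtain ⟨p, hp1, hp2⟩ := exists_rat_btwn hl
      obtain ⟨q, hq1, hq2⟩ := exists_rat_btwn hu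
      exact ⟨(p, q), hlu ⟨hp1, hp2.trans hu⟩, hlu ⟨hl.trans hq1, hq2⟩, hp2, hq1⟩
    choose q h1 h2 h3 h4 using this
    refine Set.mem_iUnion.2 ⟨⟨(fun i => (q i).1, fun i => (q i).2), h1, h2,
      fun i => ((h3 i).trans (h4 i)).le⟩, fun i _ => ⟨h3 i, (h4 i).le⟩⟩
  rw [hcover, Measure.restrict_iUnion_congr]
  rintro ⟨⟨p, q⟩, hp, hq, hpq⟩
  set C : Set (Set ℝ) := {S | ∃ l u : ℝ, l < u ∧ Set.Ioc l u = S} with hC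
  have hgen : MeasurableSpace.generateFrom (Set.univ.pi '' Set.univ.pi fun _ : Fin d => C) =
      MeasurableSpace.pi := by
    refine generateFrom_eq_pi (fun _ => ?_) fun _ => ?_
    · rw [hC, ← borel_eq_generateFrom_Ioc]
      exact (BorelSpace.measurable_eq (α := ℝ)).symm
    · refine ⟨fun n : ℕ => Set.Ioc (-(n + 1 : ℝ)) (n + 1),
        fun n => ⟨_, _, by have : (0 : ℝ) ≤ n := n.cast_nonneg
                           linarith, rfl⟩, ?_⟩
      refine Set.eq_univ_of_forall fun x => Set.mem_iUnion.2 ?_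
      obtain ⟨n, hn⟩ := exists_nat_gt |x|
      have := abs_lt.1 hn
      exact ⟨n, by constructor <;> linarith⟩
  have : IsFiniteMeasure (μ.restrict (Set.univ.pi fun i => Set.Ioc (p i : ℝ) (q i))) :=
    ⟨by rw [Measure.restrict_apply_univ]; exact (hfin _ hp _ hq).lt_top⟩
  refine ext_of_generate_finite _ hgen.symm
    (IsPiSystem.pi fun _ => by
      simpa [hC] using isPiSystem_Ioc (id : ℝ → ℝ) (id : ℝ → ℝ)) ?_ ?_
  · rintro s ⟨t, ht, rfl⟩
    have hmeas : MeasurableSet (Set.univ.pi t) := by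
      refine MeasurableSet.univ_pi fun i => ?_
      obtain ⟨l, u, -, e⟩ := ht i (Set.mem_univ i)
      rw [← e]; exact measurableSet_Ioc
    choose l u _ hlu using fun i => ht i (Set.mem_univ i)
    rw [Measure.restrict_apply hmeas, Measure.restrict_apply hmeas, ← Set.pi_inter_distrib]
    -- The endpoints are clamped to [p i, q i] and kept in order, so that even an empty intersection
    -- is a box with ordered corners inside the cube.
    have e : ∀ i, t i ∩ Set.Ioc (p i : ℝ) (q i) =
        Set.Ioc (min (max (l i) (p i)) (q i)) (max (min (max (l i) (p i)) (q i))
          (min (u i) (q i))) := by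
      intro i
      have := hpq i
      rw [← hlu i, Set.Ioc_inter_Ioc]
      ext x
      simp only [Set.mem_Ioc]
      grind
    simp only [e]
    refine h _ (fun i => hI'.out (hp i) (hq i) ⟨?_, ?_⟩) _
      (fun i => hI'.out (hp i) (hq i) ⟨?_, ?_⟩) fun i => le_max_left _ _
    · exact le_min (le_max_right _ _) (hpq i)
    · exact min_le_right _ _
    · exact le_max_of_le_left (le_min (le_max_right _ _) (hpq i))
    · exact max_le (min_le_right _ _) (min_le_right _ _)
  · rw [Measure.restrict_apply_univ, Measure.restrict_apply_univ]
    exact h _ hp _ hq hpq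

/-- The density obtained from `F` by successive differentiation, extended by zero. -/
noncomputable def partialDensity (I : Set ℝ) (F : (Fin d → ℝ) → ℝ) : (Fin d → ℝ) → ℝ :=
  (cubeOf d I).indicator (mixedPartial Finset.univ F)

/-- A suffix of a strictly increasing list is the sorted list of its own elements, and its head lies
below all the others. -/
theorem HasMixedPartialsOn.hasPartialsAlong {F : (Fin d → ℝ) → ℝ} {U : Set (Fin d → ℝ)}
    (h : HasMixedPartialsOn F U) (B : Finset (Fin d)) :
    HasPartialsAlong F U (B.sort (· ≤ ·)) := by
  intro j L hL x hx
  have hs : (j :: L).Pairwise (· ≤ ·) := (B.pairwise_sort _).sublist hL.sublist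
  have hn : (j :: L).Nodup := (B.sort_nodup _).sublist hL.sublist
  have hL' : L = L.toFinset.sort (· ≤ ·) :=
    ((List.toFinset_sort (· ≤ ·) (List.nodup_cons.1 hn).2).2 (List.pairwise_cons.1 hs).2).symm
  have := h j L.toFinset (fun k hk => by
    have hk : k ∈ L := by simpa using hk
    exact lt_of_le_of_ne ((List.pairwise_cons.1 hs).1 k hk)
      fun e => (List.nodup_cons.1 hn).1 (e ▸ hk)) x hx
  rwa [mixedPartial, ← hL'] at this

theorem measurable_partialDensity {I : Set ℝ} (hI : IsOpen I) {F : (Fin d → ℝ) → ℝ}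
    (hFm : Measurable ((cubeOf d I).indicator F)) (h : HasMixedPartialsOn F (cubeOf d I)) :
    Measurable (partialDensity I F) :=
  measurable_indicator_foldr_partialDeriv hI hFm _ (h.hasPartialsAlong _)

theorem partialDensity_nonneg {I : Set ℝ} (hI : IsOpen I) {F : (Fin d → ℝ) → ℝ}
    (hF : BoxIncreasing I Finset.univ F) (h : HasMixedPartialsOn F (cubeOf d I))
    (x : Fin d → ℝ) : 0 ≤ partialDensity I F x :=
  Set.indicator_nonneg (fun y hy => hF.foldr_partialDeriv hI _ (Finset.sort_nodup _ _)
    (h.hasPartialsAlong _) [] List.nodup_nil (by simp) y hy y hy (fun _ => le_rfl) y hy) x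

theorem withDensity_partialDensity_box {I : Set ℝ} (hI : IsOpen I) (hI' : I.OrdConnected)
    {F : (Fin d → ℝ) → ℝ} (hF : BoxIncreasing I Finset.univ F)
    (hFm : Measurable ((cubeOf d I).indicator F)) (h : HasMixedPartialsOn F (cubeOf d I))
    {a b : Fin d → ℝ} (ha : a ∈ cubeOf d I) (hb : b ∈ cubeOf d I) (hab : ∀ i, a i ≤ b i) :
    (volume.withDensity fun x => ENNReal.ofReal (partialDensity I F x))
        (Set.univ.pi fun i => Set.Ioc (a i) (b i)) =
      ENNReal.ofReal (boxDiff a b (Finset.univ.sort (· ≤ ·)) F b) := by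
  rw [ofReal_boxDiff_eq_lmarginal hI hI' hF hFm ha hb hab _ (Finset.sort_nodup _ _)
    (h.hasPartialsAlong _) b hb, Finset.sort_toFinset, lmarginal_univ,
    withDensity_apply _ (MeasurableSet.univ_pi fun _ => measurableSet_Ioc),
    ← Measure.restrict_pi_pi]
  rfl

theorem partialDensity_restrict {I : Set ℝ} (hI : IsOpen I) (F : (Fin d → ℝ) → ℝ) :
    (volume.withDensity fun x => ENNReal.ofReal (partialDensity I F x)).restrict (cubeOf d I) =
      volume.withDensity fun x => ENNReal.ofReal (partialDensity I F x) := by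
  have hU := (isOpen_cubeOf (d := d) hI).measurableSet
  rw [restrict_withDensity hU, ← withDensity_indicator hU]
  congr 1
  funext x
  by_cases hx : x ∈ cubeOf d I
  · simp [hx]
  · simp [partialDensity, hx]

/-- A finite measure whose distribution function has mixed partial derivatives on an open cube
is, on that cube, absolutely continuous, with the full mixed derivative as density. -/
theorem restrict_eq_withDensity_partialDensity (μ : Measure (Fin d → ℝ)) [IsFiniteMeasure μ]
    {I : Set ℝ} (hI : IsOpen I) (hI' : I.OrdConnected) {F : (Fin d → ℝ) → ℝ}
    (hμ : ∀ x ∈ cubeOf d I, F x = μ.real (Set.Iic x))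
    (hFm : Measurable ((cubeOf d I).indicator F)) (h : HasMixedPartialsOn F (cubeOf d I)) :
    μ.restrict (cubeOf d I) =
      volume.withDensity fun x => ENNReal.ofReal (partialDensity I F x) := by
  rw [← partialDensity_restrict hI]
  refine restrict_cubeOf_congr hI hI' (fun a ha b hb hab => ?_) fun a _ b _ => measure_ne_top _ _
  rw [withDensity_partialDensity_box hI hI' (boxIncreasing_of_cdf μ hμ _) hFm h ha hb hab,
    boxDiff_congr hμ ha hb _ b hb, boxDiff_measureReal_Iic μ hab _ (Finset.sort_nodup _ _),
    ofReal_measureReal]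
  simp

/-- Every lower-face term that is subtracted is itself nonnegative, so dropping them all leaves only
the value at the upper corner. -/
theorem boxDiff_le {I : Set ℝ} {F : (Fin d → ℝ) → ℝ} (hF : BoxIncreasing I Finset.univ F)
    {a b : Fin d → ℝ} (ha : a ∈ cubeOf d I) (hb : b ∈ cubeOf d I) (hab : ∀ i, a i ≤ b i)
    (L : List (Fin d)) (hL : L.Nodup) :
    ∀ z ∈ cubeOf d I, boxDiff a b L F z ≤ F (fun i => if i ∈ L then b i else z i) := by
  induction L with
  | nil => intro z _; simp [boxDiff]
  | cons j L ih =>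
    intro z hz
    have h1 := ih (List.nodup_cons.1 hL).2 _ (update_mem_cubeOf hz j (hb j))
    have h2 := hF L (List.nodup_cons.1 hL).2 (by simp) a ha b hb hab _
      (update_mem_cubeOf hz j (ha j))
    rw [boxDiff_cons]
    refine (sub_le_self _ h2).trans (h1.trans_eq ?_)
    congr 1
    funext i
    by_cases hij : i = j
    · subst hij; simp
    · simp [hij]

/-- A lower-face term is at most the value of F at a point with one coordinate equal to -m, hence at
most exp(-m). -/
theorem tendsto_boxDiff_atBot {F : (Fin d → ℝ) → ℝ}
    (hF : BoxIncreasing (Set.Iio 0) Finset.univ F)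
    (hle : ∀ x ∈ cubeOf d (Set.Iio 0), ∀ i, F x ≤ Real.exp (x i))
    {b : Fin d → ℝ} (hb : b ∈ cubeOf d (Set.Iio 0)) (L : List (Fin d)) (hL : L.Nodup) :
    ∀ z ∈ cubeOf d (Set.Iio 0),
      Tendsto (fun m : ℕ => boxDiff (fun _ => -(m : ℝ)) b L F z) atTop
        (𝓝 (F (fun i => if i ∈ L then b i else z i))) := by
  have hev : ∀ᶠ m : ℕ in atTop, (fun _ => -(m : ℝ)) ∈ cubeOf d (Set.Iio 0) ∧
      ∀ i, -(m : ℝ) ≤ b i := by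
    have h1 : ∀ i, ∀ᶠ m : ℕ in atTop, -(m : ℝ) ≤ b i := fun i => by
      filter_upwards [tendsto_natCast_atTop_atTop.eventually_ge_atTop (-b i)] with m hm
      linarith
    filter_upwards [eventually_all.2 h1, eventually_gt_atTop 0] with m h2 h3
    exact ⟨fun _ => by simpa using h3, h2⟩
  induction L with
  | nil => intro z _; simp [boxDiff]
  | cons j L ih =>
    intro z hz
    have hjL := (List.nodup_cons.1 hL).1
    have hL' := (List.nodup_cons.1 hL).2
    have h1 := ih hL' _ (update_mem_cubeOf hz j (hb j))
    have h2 : Tendsto (fun m : ℕ => boxDiff (fun _ => -(m : ℝ)) b L F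
        (Function.update z j (-(m : ℝ)))) atTop (𝓝 0) := by
      refine squeeze_zero' ?_ ?_
        (Real.tendsto_exp_neg_atTop_nhds_zero.comp tendsto_natCast_atTop_atTop)
      · filter_upwards [hev] with m hm
        exact hF L hL' (by simp) _ hm.1 b hb hm.2 _ (update_mem_cubeOf hz j (hm.1 j))
      · filter_upwards [hev] with m hm
        have hz' := update_mem_cubeOf hz j (hm.1 j)
        refine (boxDiff_le hF hm.1 hb hm.2 L hL' _ hz').trans ((hle _ ?_ j).trans_eq ?_)
        · intro i
          dsimp only
          split_ifs
          · exact hb i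
          · exact hz' i
        · simp [hjL]
    have h3 := h1.sub h2
    have e : (fun i => if i ∈ L then b i else Function.update z j (b j) i) =
        fun i => if i ∈ j :: L then b i else z i := by
      funext i
      by_cases hij : i = j
      · subst hij; simp
      · simp [hij]
    rw [sub_zero, e] at h3
    exact h3

/-- A box-increasing function on the negative orthant that vanishes at `-∞` in every coordinate
and has mixed partial derivatives is the distribution function of the measure with the full mixed
derivative as density. -/
theorem withDensity_partialDensity_Iic {F : (Fin d → ℝ) → ℝ}
    (hF : BoxIncreasing (Set.Iio 0) Finset.univ F)
    (hle : ∀ x ∈ cubeOf d (Set.Iio 0), ∀ i, F x ≤ Real.exp (x i))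
    (hFm : Measurable ((cubeOf d (Set.Iio 0)).indicator F))
    (h : HasMixedPartialsOn F (cubeOf d (Set.Iio 0))) {b : Fin d → ℝ}
    (hb : b ∈ cubeOf d (Set.Iio 0)) :
    (volume.withDensity fun x => ENNReal.ofReal (partialDensity (Set.Iio 0) F x)) (Set.Iic b) =
      ENNReal.ofReal (F b) := by
  set ν := volume.withDensity fun x => ENNReal.ofReal (partialDensity (Set.Iio 0) F x)
  have hmono : Monotone fun m : ℕ => Set.univ.pi fun i => Set.Ioc (-(m : ℝ)) (b i) :=
    fun m n hmn => Set.pi_mono fun i _ => Set.Ioc_subset_Ioc_left (by simpa using hmn)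
  have hU : ⋃ m : ℕ, (Set.univ.pi fun i => Set.Ioc (-(m : ℝ)) (b i)) = Set.Iic b := by
    ext x
    simp only [Set.mem_iUnion, Set.mem_pi, Set.mem_univ, true_imp_iff, Set.mem_Ioc, Set.mem_Iic]
    refine ⟨fun ⟨m, hm⟩ i => (hm i).2, fun hx => ?_⟩
    have h1 : ∀ i, ∀ᶠ m : ℕ in atTop, -(m : ℝ) < x i := fun i => by
      filter_upwards [tendsto_natCast_atTop_atTop.eventually_gt_atTop (-x i)] with m hm
      linarith
    obtain ⟨m, hm⟩ := (eventually_all.2 h1).exists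
    exact ⟨m, fun i => ⟨hm i, hx i⟩⟩
  have t1 := tendsto_measure_iUnion_atTop (μ := ν) hmono
  rw [hU] at t1
  have t2 := (ENNReal.continuous_ofReal.tendsto _).comp
    (tendsto_boxDiff_atBot hF hle hb (Finset.univ.sort (· ≤ ·)) (Finset.sort_nodup _ _) b hb)
  simp only [Finset.mem_sort, Finset.mem_univ, if_true] at t2
  refine tendsto_nhds_unique (t1.congr' ?_) t2
  have h1 : ∀ i, ∀ᶠ m : ℕ in atTop, -(m : ℝ) ≤ b i := fun i => by
    filter_upwards [tendsto_natCast_atTop_atTop.eventually_ge_atTop (-b i)] with m hm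
    linarith
  filter_upwards [eventually_all.2 h1, eventually_gt_atTop 0] with m h2 h3
  exact withDensity_partialDensity_box isOpen_Iio Set.ordConnected_Iio hF hFm h
    (a := fun _ => -(m : ℝ)) (fun _ => by simpa using h3) hb h2

end Densities

/-! ### Mixed partial derivatives of compositions. -/

section MixedPartials

variable {d : ℕ}

theorem mixedPartial_empty (f : (Fin d → ℝ) → ℝ) : mixedPartial ∅ f = f := by
  simp [mixedPartial]

theorem mixedPartial_insert {i : Fin d} {B : Finset (Fin d)} (h : ∀ j ∈ B, i < j)
    (f : (Fin d → ℝ) → ℝ) :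
    mixedPartial (insert i B) f = partialDeriv i (mixedPartial B f) := by
  rw [mixedPartial, Finset.sort_insert _ (fun j hj => (h j hj).le)
    fun hi => lt_irrefl _ (h i hi)]
  rfl

theorem mixedPartial_neg (f : (Fin d → ℝ) → ℝ) (B : Finset (Fin d)) :
    mixedPartial B (fun x => -f x) = fun x => -mixedPartial B f x := by
  induction B using Finset.induction_on_min with
  | empty => simp [mixedPartial_empty]
  | insert i B hi ih =>
    funext x
    rw [mixedPartial_insert hi, mixedPartial_insert hi, ih]
    simp only [partialDeriv, lineDeriv]
    exact deriv.fun_neg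

theorem HasMixedPartialsOn.neg {f : (Fin d → ℝ) → ℝ} {U : Set (Fin d → ℝ)}
    (h : HasMixedPartialsOn f U) : HasMixedPartialsOn (fun x => -f x) U := by
  intro i B hi x hx
  rw [mixedPartial_neg]
  exact DifferentiableAt.neg (h i B hi x hx)

theorem HasMixedPartialsOn.hasLineDerivAt {f : (Fin d → ℝ) → ℝ} {U : Set (Fin d → ℝ)}
    (h : HasMixedPartialsOn f U) {i : Fin d} {B : Finset (Fin d)} (hi : ∀ j ∈ B, i < j)
    {x : Fin d → ℝ} (hx : x ∈ U) :
    HasLineDerivAt ℝ (mixedPartial B f) (mixedPartial (insert i B) f x) x (Pi.single i 1) := by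
  rw [mixedPartial_insert hi]
  exact (h i B hi x hx).hasLineDerivAt

theorem ContDiffOn.mixedPartial {U : Set (Fin d → ℝ)} (hU : IsOpen U) {m : ℕ}
    {f : (Fin d → ℝ) → ℝ} (hf : ContDiffOn ℝ m f U) (B : Finset (Fin d)) (hB : B.card ≤ m) :
    ContDiffOn ℝ ((m - B.card : ℕ) : ℕ) (mixedPartial B f) U := by
  induction B using Finset.induction_on_min with
  | empty => simpa [mixedPartial_empty] using hf
  | insert i B hi ih =>
    have hiB : i ∉ B := fun h => lt_irrefl _ (hi i h)
    rw [Finset.card_insert_of_notMem hiB] at hB ⊢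
    have ih := ih (by omega)
    rw [mixedPartial_insert hi]
    have h1 : ContDiffOn ℝ ((m - (B.card + 1) : ℕ) : ℕ)
        (fun x => fderiv ℝ (_root_.mixedPartial B f) x (Pi.single i 1)) U := by
      refine (ih.fderiv_of_isOpen hU ?_).clm_apply contDiffOn_const
      have : m - (B.card + 1) + 1 = m - B.card := by omega
      exact_mod_cast this.le
    refine h1.congr fun x hx => ?_
    have hd : DifferentiableAt ℝ (_root_.mixedPartial B f) x :=
      (ih.differentiableOn (by
        have : m - B.card ≠ 0 := by omega
        exact_mod_cast this)).differentiableAt (hU.mem_nhds hx)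
    exact hd.lineDeriv_eq_fderiv

theorem ContDiffOn.hasMixedPartialsOn {U : Set (Fin d → ℝ)} (hU : IsOpen U)
    {f : (Fin d → ℝ) → ℝ} (hf : ContDiffOn ℝ d f U) : HasMixedPartialsOn f U := by
  intro i B hi x hx
  have hB : B.card < d := by
    simpa using Finset.card_lt_univ_of_notMem (x := i) fun h => lt_irrefl _ (hi i h)
  have h1 := ContDiffOn.mixedPartial hU hf B hB.le
  exact ((h1.differentiableOn (by
    have : d - B.card ≠ 0 := by omega
    exact_mod_cast this)).differentiableAt (hU.mem_nhds hx)).lineDifferentiableAt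

/-- Expressions built from the derivatives of an outer function at an inner function and the
mixed partial derivatives of the inner function; they record the terms of Faà di Bruno's
formula. -/
inductive ChainExpr (d : ℕ) : Type
  | outer (k : ℕ) : ChainExpr d
  | inner (B : Finset (Fin d)) : ChainExpr d
  | add (e₁ e₂ : ChainExpr d) : ChainExpr d
  | mul (e₁ e₂ : ChainExpr d) : ChainExpr d

namespace ChainExpr

/-- The value of an expression for the outer derivatives `Φ k` and the inner function `g`. -/
noncomputable def eval (Φ : ℕ → ℝ → ℝ) (g : (Fin d → ℝ) → ℝ) : ChainExpr d → (Fin d → ℝ) → ℝ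
  | outer k => fun x => Φ k (g x)
  | inner B => mixedPartial B g
  | add e₁ e₂ => fun x => eval Φ g e₁ x + eval Φ g e₂ x
  | mul e₁ e₂ => fun x => eval Φ g e₁ x * eval Φ g e₂ x

/-- The formal derivative of an expression in the `i`-th variable. -/
def diff (i : Fin d) : ChainExpr d → ChainExpr d
  | outer k => mul (outer (k + 1)) (inner {i})
  | inner B => inner (insert i B)
  | add e₁ e₂ => add (diff i e₁) (diff i e₂)
  | mul e₁ e₂ => add (mul (diff i e₁) e₂) (mul e₁ (diff i e₂))

/-- All blocks occurring in the expression are nonempty subsets of `B`. -/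
def BlocksIn (B : Finset (Fin d)) : ChainExpr d → Prop
  | outer _ => True
  | inner B' => B'.Nonempty ∧ B' ⊆ B
  | add e₁ e₂ => BlocksIn B e₁ ∧ BlocksIn B e₂
  | mul e₁ e₂ => BlocksIn B e₁ ∧ BlocksIn B e₂

theorem BlocksIn.mono {B B' : Finset (Fin d)} (hB : B ⊆ B') {e : ChainExpr d}
    (h : e.BlocksIn B) : e.BlocksIn B' := by
  induction e with
  | outer k => trivial
  | inner A => exact ⟨h.1, h.2.trans hB⟩
  | add e₁ e₂ h₁ h₂ => exact ⟨h₁ h.1, h₂ h.2⟩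
  | mul e₁ e₂ h₁ h₂ => exact ⟨h₁ h.1, h₂ h.2⟩

theorem BlocksIn.diff {B : Finset (Fin d)} (i : Fin d) {e : ChainExpr d}
    (h : e.BlocksIn B) : (e.diff i).BlocksIn (insert i B) := by
  induction e with
  | outer k => exact ⟨trivial, by simp, by simp⟩
  | inner A => exact ⟨by simp, Finset.insert_subset_insert i h.2⟩
  | add e₁ e₂ h₁ h₂ => exact ⟨h₁ h.1, h₂ h.2⟩
  | mul e₁ e₂ h₁ h₂ =>
    exact ⟨⟨h₁ h.1, h.2.mono (Finset.subset_insert i B)⟩,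
      ⟨h.1.mono (Finset.subset_insert i B), h₂ h.2⟩⟩

/-- Since i precedes every index in the blocks, differentiating an inner factor only enlarges its
block in the prescribed order. No interchange of partial derivatives is needed. -/
theorem hasLineDerivAt_eval {Φ : ℕ → ℝ → ℝ} (hΦ : ∀ k t, HasDerivAt (Φ k) (Φ (k + 1) t) t)
    {g : (Fin d → ℝ) → ℝ} {U : Set (Fin d → ℝ)} (hg : HasMixedPartialsOn g U)
    {B : Finset (Fin d)} {i : Fin d} (hi : ∀ j ∈ B, i < j) {e : ChainExpr d}
    (he : e.BlocksIn B) {x : Fin d → ℝ} (hx : x ∈ U) :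
    HasLineDerivAt ℝ (e.eval Φ g) ((e.diff i).eval Φ g x) x (Pi.single i 1) := by
  induction e with
  | outer k =>
    have h1 := hg.hasLineDerivAt (i := i) (B := ∅) (by simp) hx
    rw [mixedPartial_empty, insert_empty_eq] at h1
    unfold HasLineDerivAt at h1 ⊢
    refine HasDerivAt.comp (h₂ := Φ k) (h₂' := Φ (k + 1) (g x)) 0 ?_ h1
    simpa using hΦ k (g x)
  | inner A => exact hg.hasLineDerivAt (fun j hj => hi j (he.2 hj)) hx
  | add e₁ e₂ h₁ h₂ => exact HasDerivAt.add (h₁ he.1) (h₂ he.2)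
  | mul e₁ e₂ h₁ h₂ =>
    have := HasDerivAt.mul (h₁ he.1) (h₂ he.2)
    simp only [zero_smul, add_zero] at this
    exact this

theorem tendsto_eval {Φ : ℕ → ℕ → ℝ → ℝ} {Φ' : ℕ → ℝ → ℝ} {g : ℕ → (Fin d → ℝ) → ℝ}
    {g' : (Fin d → ℝ) → ℝ} {x : Fin d → ℝ}
    (hΦ : ∀ k, Tendsto (fun n => Φ n k (g n x)) atTop (𝓝 (Φ' k (g' x))))
    (hg : ∀ B : Finset (Fin d), B.Nonempty →
      Tendsto (fun n => mixedPartial B (g n) x) atTop (𝓝 (mixedPartial B g' x)))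
    {B : Finset (Fin d)} {e : ChainExpr d} (he : e.BlocksIn B) :
    Tendsto (fun n => e.eval (Φ n) (g n) x) atTop (𝓝 (e.eval Φ' g' x)) := by
  induction e with
  | outer k => exact hΦ k
  | inner A => exact hg A he.1
  | add e₁ e₂ h₁ h₂ => exact (h₁ he.1).add (h₂ he.2)
  | mul e₁ e₂ h₁ h₂ => exact (h₁ he.1).mul (h₂ he.2)

/-- The mixed partial derivatives of a composition are given by a universal expression. -/
theorem exists_eval_eq_mixedPartial (B : Finset (Fin d)) :
    ∃ e : ChainExpr d, e.BlocksIn B ∧ ∀ (Φ : ℕ → ℝ → ℝ) (g : (Fin d → ℝ) → ℝ)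
      (U : Set (Fin d → ℝ)), IsOpen U → (∀ k t, HasDerivAt (Φ k) (Φ (k + 1) t) t) →
      HasMixedPartialsOn g U →
        ∀ x ∈ U, mixedPartial B (fun y => Φ 0 (g y)) x = e.eval Φ g x := by
  induction B using Finset.induction_on_min with
  | empty => exact ⟨outer 0, trivial, fun Φ g U _ _ _ x _ => by rw [mixedPartial_empty]; rfl⟩
  | insert i B hi ih =>
    obtain ⟨e, he, h⟩ := ih
    refine ⟨e.diff i, he.diff i, fun Φ g U hU hΦ hg x hx => ?_⟩
    rw [mixedPartial_insert hi]
    -- Equality on an open set is enough to replace one function by the other under the derivative.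
    have h1 : Set.EqOn (mixedPartial B fun y => Φ 0 (g y)) (e.eval Φ g) U :=
      h Φ g U hU hΦ hg
    exact (h1.eventuallyEq_of_mem (hU.mem_nhds hx)).lineDeriv_eq.trans
      (hasLineDerivAt_eval hΦ hg hi he hx).lineDeriv

end ChainExpr

theorem HasMixedPartialsOn.comp {Φ : ℕ → ℝ → ℝ}
    (hΦ : ∀ k t, HasDerivAt (Φ k) (Φ (k + 1) t) t) {g : (Fin d → ℝ) → ℝ}
    {U : Set (Fin d → ℝ)} (hU : IsOpen U) (hg : HasMixedPartialsOn g U) :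
    HasMixedPartialsOn (fun y => Φ 0 (g y)) U := by
  intro i B hi x hx
  obtain ⟨e, he, h⟩ := ChainExpr.exists_eval_eq_mixedPartial B
  have h1 : Set.EqOn (mixedPartial B fun y => Φ 0 (g y)) (e.eval Φ g) U :=
    h Φ g U hU hΦ hg
  exact (h1.eventuallyEq_of_mem (hU.mem_nhds hx)).lineDifferentiableAt_iff.2
    (ChainExpr.hasLineDerivAt_eval hΦ hg hi he hx).lineDifferentiableAt

theorem tendsto_mixedPartial_comp {Φ : ℕ → ℕ → ℝ → ℝ} {Φ' : ℕ → ℝ → ℝ}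
    {g : ℕ → (Fin d → ℝ) → ℝ} {g' : (Fin d → ℝ) → ℝ} {U : ℕ → Set (Fin d → ℝ)}
    {U' : Set (Fin d → ℝ)} (hU : ∀ n, IsOpen (U n)) (hU' : IsOpen U')
    (hΦ : ∀ᶠ n in atTop, ∀ k t, HasDerivAt (Φ n k) (Φ n (k + 1) t) t)
    (hΦ' : ∀ k t, HasDerivAt (Φ' k) (Φ' (k + 1) t) t)
    (hg : ∀ᶠ n in atTop, HasMixedPartialsOn (g n) (U n)) (hg' : HasMixedPartialsOn g' U')
    {x : Fin d → ℝ} (hx : ∀ᶠ n in atTop, x ∈ U n) (hx' : x ∈ U')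
    (hΦ_lim : ∀ k, Tendsto (fun n => Φ n k (g n x)) atTop (𝓝 (Φ' k (g' x))))
    (hg_lim : ∀ B : Finset (Fin d), B.Nonempty →
      Tendsto (fun n => mixedPartial B (g n) x) atTop (𝓝 (mixedPartial B g' x)))
    (B : Finset (Fin d)) :
    Tendsto (fun n => mixedPartial B (fun y => Φ n 0 (g n y)) x) atTop
      (𝓝 (mixedPartial B (fun y => Φ' 0 (g' y)) x)) := by
  obtain ⟨e, he, h⟩ := ChainExpr.exists_eval_eq_mixedPartial B
  rw [h Φ' g' U' hU' hΦ' hg' x hx']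
  refine (ChainExpr.tendsto_eval hΦ_lim hg_lim he).congr' ?_
  filter_upwards [hΦ, hg, hx] with n h1 h2 h3
  exact (h (Φ n) (g n) (U n) (hU n) h1 h2 x h3).symm

/-- The `k`-th derivative of `t ↦ (1 + t / n) ^ n`. -/
noncomputable def powDeriv (n k : ℕ) (t : ℝ) : ℝ :=
  (n.descFactorial k / (n : ℝ) ^ k) * (1 + t / n) ^ (n - k)

/-- Truncated subtraction in the exponent is harmless: the falling factorial gains the factor n - k,
which is zero from k = n on. -/
theorem hasDerivAt_powDeriv {n : ℕ} (hn : n ≠ 0) (k : ℕ) (t : ℝ) :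
    HasDerivAt (powDeriv n k) (powDeriv n (k + 1) t) t := by
  have hn' : (n : ℝ) ≠ 0 := by exact_mod_cast hn
  have h1 : HasDerivAt (fun t : ℝ => 1 + t / n) (1 / n) t :=
    ((hasDerivAt_id t).div_const _).const_add _
  have h2 := (h1.pow (n - k)).const_mul (n.descFactorial k / (n : ℝ) ^ k)
  refine HasDerivAt.congr_deriv (f := powDeriv n k) h2 ?_
  rw [powDeriv, Nat.descFactorial_succ, show n - (k + 1) = n - k - 1 by omega]
  push_cast
  field_simp
  ring

theorem tendsto_descFactorial_div_pow (k : ℕ) :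
    Tendsto (fun n : ℕ => (n.descFactorial k / (n : ℝ) ^ k : ℝ)) atTop (𝓝 1) := by
  induction k with
  | zero => simp
  | succ k ih =>
    have h1 : Tendsto (fun n : ℕ => 1 - (k : ℝ) / n) atTop (𝓝 1) := by
      simpa using (tendsto_const_div_atTop_nhds_zero_nat (k : ℝ)).const_sub 1
    have h2 := h1.mul ih
    rw [mul_one] at h2
    refine h2.congr' ?_
    filter_upwards [eventually_ge_atTop k, eventually_gt_atTop 0] with n hn hn0
    have hn' : (n : ℝ) ≠ 0 := by exact_mod_cast hn0.ne'
    rw [Nat.descFactorial_succ, Nat.cast_mul, Nat.cast_sub hn]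
    field_simp
    ring

/-- The power with exponent n - k is (1 + t/n)^n divided by (1 + t/n)^k, and the divisor tends to 1.
The limit is the same for all k, as exp is its own derivative. -/
theorem tendsto_powDeriv {t : ℕ → ℝ} {s : ℝ} (ht : Tendsto t atTop (𝓝 s)) (k : ℕ) :
    Tendsto (fun n => powDeriv n k (t n)) atTop (𝓝 (Real.exp s)) := by
  have h0 : Tendsto (fun n : ℕ => t n / n) atTop (𝓝 0) :=
    ht.div_atTop tendsto_natCast_atTop_atTop
  have h1 : Tendsto (fun n : ℕ => (1 + t n / n) ^ n) atTop (𝓝 (Real.exp s)) := by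
    refine Real.tendsto_one_add_pow_exp_of_tendsto (ht.congr' ?_)
    filter_upwards [eventually_gt_atTop 0] with n hn
    have : (n : ℝ) ≠ 0 := by exact_mod_cast hn.ne'
    field_simp
  have h2 : Tendsto (fun n : ℕ => (1 + t n / n) ^ k) atTop (𝓝 1) := by
    simpa using (h0.const_add 1).pow k
  have h3 := (tendsto_descFactorial_div_pow k).mul (h1.div h2 one_ne_zero)
  rw [div_one, one_mul] at h3
  refine h3.congr' ?_
  filter_upwards [eventually_ge_atTop k, (h0.const_add 1).eventually_ne (b₂ := 0) (by simp)]
    with n hn hne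
  rw [powDeriv, pow_sub₀ _ hne hn]
  rfl

end MixedPartials

/-! ### Elementary properties of D-norms. -/

section DNorms

variable {d : ℕ} {N : (Fin d → ℝ) → ℝ}

theorem IsDNorm.comp_abs (hN : IsDNorm N) (x : Fin d → ℝ) : N (fun i => |x i|) = N x := by
  obtain ⟨ζ, -, -, -, h⟩ := hN
  simp [h]

theorem IsDNorm.apply_neg (hN : IsDNorm N) (x : Fin d → ℝ) : N (-x) = N x := by
  rw [← hN.comp_abs, ← hN.comp_abs x]
  simp

theorem IsDNorm.smul (hN : IsDNorm N) {c : ℝ} (hc : 0 ≤ c) (x : Fin d → ℝ) :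
    N (c • x) = c * N x := by
  obtain ⟨ζ, -, -, -, h⟩ := hN
  rw [h, h, ← integral_const_mul]
  congr 1
  funext z
  rw [Real.mul_iSup_of_nonneg hc]
  congr 1
  funext i
  rw [Pi.smul_apply, smul_eq_mul, abs_mul, abs_of_nonneg hc, mul_assoc]

theorem integrable_iSup_abs_mul {ζ : Measure (Fin d → ℝ)}
    (h0 : ∀ i, ∀ᵐ z ∂ζ, 0 ≤ z i) (h1 : ∀ i, Integrable (fun z : Fin d → ℝ => z i) ζ)
    (x : Fin d → ℝ) : Integrable (fun z : Fin d → ℝ => ⨆ i, |x i| * z i) ζ := by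
  have hs : Integrable (fun z : Fin d → ℝ => ∑ i, |x i| * z i) ζ :=
    integrable_finsetSum _ fun i _ => (h1 i).const_mul _
  refine hs.mono' (Measurable.iSup fun i => (measurable_pi_apply i).const_mul _
    ).aestronglyMeasurable ?_
  filter_upwards [ae_all_iff.2 h0] with z hz
  have hz' : ∀ i, 0 ≤ |x i| * z i := fun i => mul_nonneg (abs_nonneg _) (hz i)
  rw [Real.norm_of_nonneg (Real.iSup_nonneg hz')]
  exact Real.iSup_le (fun i => Finset.single_le_sum (f := fun i => |x i| * z i)
    (fun j _ => hz' j) (Finset.mem_univ i)) (Finset.sum_nonneg fun j _ => hz' j)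

/-- The bound max |y_i| z_i ≤ max |x_i| z_i + Σ |x_i - y_i| z_i holds for nonnegative z; taking
expectations with E Z_i = 1 gives the claim. It makes N Lipschitz for the ℓ¹ norm. -/
theorem IsDNorm.le_add_sum (hN : IsDNorm N) (x y : Fin d → ℝ) :
    N y ≤ N x + ∑ i, |x i - y i| := by
  obtain ⟨ζ, _, h0, h1, h⟩ := hN
  have hs : Integrable (fun z : Fin d → ℝ => ∑ i, |x i - y i| * z i) ζ :=
    integrable_finsetSum _ fun i _ => (h1 i).1.const_mul _
  have hx := integrable_iSup_abs_mul h0 (fun i => (h1 i).1) x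
  have hsum : ∑ i, |x i - y i| = ∫ z, ∑ i, |x i - y i| * z i ∂ζ := by
    rw [integral_finsetSum _ fun i _ => (h1 i).1.const_mul _]
    refine Finset.sum_congr rfl fun i _ => ?_
    rw [integral_const_mul, (h1 i).2, mul_one]
  rw [h, h, hsum, ← integral_add hx hs]
  refine integral_mono_ae (integrable_iSup_abs_mul h0 (fun i => (h1 i).1) y) (hx.add hs) ?_
  filter_upwards [ae_all_iff.2 h0] with z hz
  have hnn : ∀ (w : Fin d → ℝ) i, 0 ≤ |w i| * z i :=
    fun w i => mul_nonneg (abs_nonneg _) (hz i)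
  have hnn' : ∀ i, 0 ≤ |x i - y i| * z i := fun i => mul_nonneg (abs_nonneg _) (hz i)
  refine Real.iSup_le (fun i => ?_)
    (add_nonneg (Real.iSup_nonneg (hnn x)) (Finset.sum_nonneg fun i _ => hnn' i))
  have e1 : |x i| * z i ≤ ⨆ i, |x i| * z i :=
    le_ciSup (Set.finite_range fun i => |x i| * z i).bddAbove i
  have e2 : |x i - y i| * z i ≤ ∑ i, |x i - y i| * z i :=
    Finset.single_le_sum (f := fun i => |x i - y i| * z i) (fun j _ => hnn' j)
      (Finset.mem_univ i)
  have e3 : |y i| ≤ |x i| + |x i - y i| := by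
    have := abs_sub_abs_le_abs_sub (y i) (x i)
    rw [abs_sub_comm] at this
    linarith
  have e4 := mul_le_mul_of_nonneg_right e3 (hz i)
  rw [add_mul] at e4
  exact e4.trans (add_le_add e1 e2)

theorem IsDNorm.continuous (hN : IsDNorm N) : Continuous N := by
  rw [continuous_iff_continuousAt]
  intro x
  rw [ContinuousAt, tendsto_iff_dist_tendsto_zero]
  have h : Tendsto (fun y : Fin d → ℝ => ∑ i, |x i - y i|) (𝓝 x) (𝓝 0) := by
    have : Continuous fun y : Fin d → ℝ => ∑ i, |x i - y i| := by fun_prop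
    simpa using this.tendsto x
  refine squeeze_zero (fun _ => dist_nonneg) (fun y => ?_) h
  rw [Real.dist_eq, abs_le]
  have h1 := hN.le_add_sum x y
  have h2 := hN.le_add_sum y x
  simp only [abs_sub_comm (y _) (x _)] at h2
  constructor <;> linarith

/-- The maximum dominates its i-th term, whose expectation is |x i|. This forces exp(-N) to vanish
when any coordinate tends to -∞. -/
theorem IsDNorm.abs_le (hN : IsDNorm N) (x : Fin d → ℝ) (i : Fin d) : |x i| ≤ N x := by
  obtain ⟨ζ, _, h0, h1, h⟩ := hN
  have e : |x i| = ∫ z, |x i| * z i ∂ζ := by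
    rw [integral_const_mul, (h1 i).2, mul_one]
  rw [e, h]
  exact integral_mono ((h1 i).1.const_mul _) (integrable_iSup_abs_mul h0 (fun i => (h1 i).1) x)
    fun z => le_ciSup (Set.finite_range fun i => |x i| * z i).bddAbove i

theorem IsDNorm.apply_zero (hN : IsDNorm N) : N 0 = 0 := by
  simpa using hN.smul le_rfl (0 : Fin d → ℝ)

theorem IsDNorm.apply_single (hN : IsDNorm N) (i : Fin d) (c : ℝ) :
    N (Pi.single i c) = |c| := by
  refine le_antisymm ?_ (by simpa using hN.abs_le (Pi.single i c) i)
  have := hN.le_add_sum 0 (Pi.single i c)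
  rw [hN.apply_zero, zero_add] at this
  refine this.trans_eq ?_
  rw [Finset.sum_eq_single i]
  · simp
  · intro j _ hj; simp [hj]
  · simp

end DNorms

/-! ### Margins of copulas, copulas of maxima and logarithmic coordinates. -/

section Copulas

variable {d : ℕ}

theorem update_one_mem_Icc (i : Fin d) {t : ℝ} (ht : t ∈ Set.Icc (0 : ℝ) 1) :
    Function.update (1 : Fin d → ℝ) i t ∈ Set.Icc (0 : Fin d → ℝ) 1 := by
  constructor <;> intro j <;> by_cases h : j = i
  · subst h; simpa using ht.1
  · simp [h]
  · subst h; simpa using ht.2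
  · simp [h]

/-- Margins can thus be read off from the distribution function on the cube, at points whose other
coordinates equal 1. -/
theorem measureReal_le_eq_Iic_update {P : Measure (Fin d → ℝ)} [IsProbabilityMeasure P]
    (h : ∀ᵐ u ∂P, u ≤ 1) (i : Fin d) (t : ℝ) :
    P.real {u | u i ≤ t} = P.real (Set.Iic (Function.update 1 i t)) := by
  refine measureReal_congr ?_
  filter_upwards [h] with u hu
  refine propext ⟨fun hi j => ?_, fun hi => ?_⟩
  · have hi : u i ≤ t := hi
    by_cases e : j = i
    · subst e; simpa using hi
    · simpa [e] using hu j
  · have hi : ∀ j, u j ≤ Function.update (1 : Fin d → ℝ) i t j := hi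
    have hi := hi i
    rwa [Function.update_self] at hi

theorem HasCubeCDF.ae_le_one {P : Measure (Fin d → ℝ)} {F : (Fin d → ℝ) → ℝ}
    (hP : HasCubeCDF P F) (h1 : F 1 = 1) : ∀ᵐ u ∂P, u ≤ 1 := by
  have := hP.1
  have h : P.real (Set.Iic 1) = 1 := by
    rw [hP.2 1 ⟨zero_le_one, le_rfl⟩, h1]
  have h2 : P (Set.Iic 1)ᶜ = 0 := by
    have e := probReal_compl_eq_one_sub (μ := P) (measurableSet_Iic (a := (1 : Fin d → ℝ)))
    rw [h, sub_self] at e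
    exact (measureReal_eq_zero_iff).1 e
  exact h2

theorem isCopula_of_hasCubeCDF {P : Measure (Fin d → ℝ)} {F : (Fin d → ℝ) → ℝ}
    (hP : HasCubeCDF P F) (h1 : F 1 = 1)
    (h : ∀ i, ∀ t ∈ Set.Icc (0 : ℝ) 1, F (Function.update 1 i t) = t) : IsCopula F := by
  have := hP.1
  refine ⟨P, hP, fun i t ht => ?_⟩
  rw [measureReal_le_eq_Iic_update (hP.ae_le_one h1) i t, hP.2 _ (update_one_mem_Icc i ht),
    h i t ht]

theorem ae_le_one_of_marginals {P : Measure (Fin d → ℝ)} [IsProbabilityMeasure P]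
    (h : ∀ i : Fin d, ∀ t ∈ Set.Icc (0 : ℝ) 1, P.real {u | u i ≤ t} = t) :
    ∀ᵐ u ∂P, u ≤ 1 := by
  have : ∀ᵐ u ∂P, ∀ i, u i ≤ 1 := by
    refine ae_all_iff.2 fun i => ?_
    have hm : MeasurableSet {u : Fin d → ℝ | u i ≤ 1} :=
      measurableSet_le (measurable_pi_apply i) measurable_const
    have e := probReal_compl_eq_one_sub (μ := P) hm
    rw [h i 1 ⟨zero_le_one, le_rfl⟩, sub_self] at e
    exact (measureReal_eq_zero_iff).1 e
  exact this

theorem IsCopula.apply_one {F : (Fin d → ℝ) → ℝ} (hF : IsCopula F) : F 1 = 1 := by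
  obtain ⟨P, hP, h⟩ := hF
  have := hP.1
  rw [← hP.2 1 ⟨zero_le_one, le_rfl⟩]
  have h1 := ae_le_one_of_marginals h
  rw [measureReal_congr (t := Set.univ), probReal_univ]
  filter_upwards [h1] with u hu
  exact propext ⟨fun _ => trivial, fun _ => hu⟩

theorem IsCopula.apply_update {F : (Fin d → ℝ) → ℝ} (hF : IsCopula F) (i : Fin d) {t : ℝ}
    (ht : t ∈ Set.Icc (0 : ℝ) 1) : F (Function.update 1 i t) = t := by
  obtain ⟨P, hP, h⟩ := hF
  have := hP.1
  rw [← hP.2 _ (update_one_mem_Icc i ht),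
    ← measureReal_le_eq_Iic_update (ae_le_one_of_marginals h) i t, h i t ht]

/-- Uniform margins charge neither endpoint. Hence the logarithm is almost surely finite, negative
and inverted by the exponential. -/
theorem HasCubeCDF.ae_mem_Ioo {P : Measure (Fin d → ℝ)} {F : (Fin d → ℝ) → ℝ}
    (hP : HasCubeCDF P F) (hF : IsCopula F) : ∀ᵐ u ∂P, ∀ i, u i ∈ Set.Ioo (0 : ℝ) 1 := by
  have := hP.1
  have hm : ∀ (i : Fin d), ∀ t ∈ Set.Icc (0 : ℝ) 1, P.real {u | u i ≤ t} = t := by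
    intro i t ht
    rw [measureReal_le_eq_Iic_update (hP.ae_le_one hF.apply_one) i t,
      hP.2 _ (update_one_mem_Icc i ht), hF.apply_update i ht]
  refine ae_all_iff.2 fun i => ?_
  have h0 : ∀ᵐ u ∂P, 0 < u i := by
    have e := hm i 0 ⟨le_rfl, zero_le_one⟩
    have e := (measureReal_eq_zero_iff).1 e
    filter_upwards [measure_eq_zero_iff_ae_notMem.1 e] with u hu
    simpa using hu
  have h1 : ∀ᵐ u ∂P, u i < 1 := by
    have e : P.real {u | 1 ≤ u i} = 0 := by
      refine le_antisymm (le_of_forall_pos_le_add fun ε hε => ?_) measureReal_nonneg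
      -- The margin is known only on [0,1], whence the maximum with 0; then P(u_i ≥ 1) ≤ 1 - t ≤ ε.
      set t : ℝ := max 0 (1 - ε) with ht
      have ht' : t ∈ Set.Icc (0 : ℝ) 1 := ⟨le_max_left _ _, max_le zero_le_one (by linarith)⟩
      have htε : 1 - ε ≤ t := le_max_right _ _
      have ht1 : t < 1 := max_lt zero_lt_one (by linarith)
      have hmeas : MeasurableSet {u : Fin d → ℝ | u i ≤ t} :=
        measurableSet_le (measurable_pi_apply i) measurable_const
      have e1 := probReal_compl_eq_one_sub (μ := P) hmeas
      rw [hm i t ht'] at e1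
      have e2 : P.real {u | 1 ≤ u i} ≤ P.real {u | u i ≤ t}ᶜ :=
        measureReal_mono fun u hu => by
          simp only [Set.mem_compl_iff, Set.mem_ofPred_eq, not_le] at hu ⊢
          linarith
      linarith
    have e := (measureReal_eq_zero_iff).1 e
    filter_upwards [measure_eq_zero_iff_ae_notMem.1 e] with u hu
    simpa using hu
  filter_upwards [h0, h1] with u hu0 hu1
  exact ⟨hu0, hu1⟩

/-- Clamping at 0 makes the n-th power monotone also for even n, so that in `isCopula_maxCopula`
preimages of orthants are exactly products of orthants. -/
theorem max_zero_pow_le_iff {n : ℕ} (hn : n ≠ 0) {s u : ℝ} (hu : 0 ≤ u) :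
    (max s 0) ^ n ≤ u ↔ s ≤ u ^ ((1 : ℝ) / n) := by
  have h0 : 0 ≤ u ^ ((1 : ℝ) / n) := Real.rpow_nonneg hu _
  have e : u = (u ^ ((1 : ℝ) / n)) ^ n := by
    rw [one_div, Real.rpow_inv_natCast_pow hu hn]
  conv_lhs => rw [e]
  rw [pow_le_pow_iff_left₀ (le_max_right _ _) h0 hn, max_le_iff]
  exact and_iff_left h0

theorem isCopula_maxCopula {C : (Fin d → ℝ) → ℝ} (hC : IsCopula C) {n : ℕ} (hn : 1 ≤ n) :
    IsCopula (maxCopula C n) := by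
  have hn0 : n ≠ 0 := by omega
  have : Nonempty (Fin n) := ⟨⟨0, hn⟩⟩
  obtain ⟨μ, hμ, -⟩ := id hC
  have := hμ.1
  -- The witness is the law of the n-th powers of the componentwise maxima of n independent vectors
  -- with distribution C.
  set T : (Fin n → Fin d → ℝ) → (Fin d → ℝ) := fun ω i => (max (⨆ k, ω k i) 0) ^ n with hT
  have hTm : Measurable T := by
    refine measurable_pi_iff.2 fun i => ?_
    refine Measurable.pow_const (Measurable.max (Measurable.iSup fun k => ?_)
      measurable_const) n
    exact (measurable_pi_apply i).comp (measurable_pi_apply k)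
  have hone : ((1 : ℝ) ^ ((1 : ℝ) / n)) = 1 := Real.one_rpow _
  refine isCopula_of_hasCubeCDF (P := (Measure.pi fun _ : Fin n => μ).map T) ⟨?_, ?_⟩ ?_ ?_
  · exact Measure.isProbabilityMeasure_map hTm.aemeasurable
  · intro u hu
    have hset : T ⁻¹' Set.Iic u =
        Set.univ.pi fun _ : Fin n => Set.Iic fun i => u i ^ ((1 : ℝ) / n) := by
      ext ω
      simp only [Set.mem_preimage, Set.mem_Iic, Set.mem_pi, Set.mem_univ, true_imp_iff, Pi.le_def,
        hT]
      rw [forall_comm]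
      refine forall_congr' fun i => ?_
      rw [max_zero_pow_le_iff hn0 (hu.1 i), ciSup_le_iff (Set.finite_range _).bddAbove]
    have hu' : (fun i => u i ^ ((1 : ℝ) / n)) ∈ Set.Icc (0 : Fin d → ℝ) 1 :=
      ⟨fun i => Real.rpow_nonneg (hu.1 i) _,
        fun i => Real.rpow_le_one (hu.1 i) (hu.2 i) (by positivity)⟩
    rw [map_measureReal_apply hTm measurableSet_Iic, hset, measureReal_def, Measure.pi_pi,
      Finset.prod_const, Finset.card_univ, Fintype.card_fin, ENNReal.toReal_pow,
      ← measureReal_def, hμ.2 _ hu']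
    rfl
  · simp only [maxCopula, Pi.one_apply, hone]
    have := hC.apply_one
    rw [show (1 : Fin d → ℝ) = fun _ => 1 from rfl] at this
    rw [this, one_pow]
  · intro i t ht
    have e : (fun j => Function.update (1 : Fin d → ℝ) i t j ^ ((1 : ℝ) / n)) =
        Function.update (1 : Fin d → ℝ) i (t ^ ((1 : ℝ) / n)) := by
      funext j
      by_cases h : j = i
      · subst h; simp
      · simp [h]
    rw [maxCopula, e, hC.apply_update i
      ⟨Real.rpow_nonneg ht.1 _, Real.rpow_le_one ht.1 ht.2 (by positivity)⟩, one_div,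
      Real.rpow_inv_natCast_pow ht.1 hn0]

/-- The coordinatewise logarithm. -/
noncomputable def logMap (u : Fin d → ℝ) : Fin d → ℝ := fun i => Real.log (u i)

/-- The coordinatewise exponential. -/
noncomputable def expMap (x : Fin d → ℝ) : Fin d → ℝ := fun i => Real.exp (x i)

theorem measurable_logMap : Measurable (logMap (d := d)) :=
  measurable_pi_iff.2 fun i => Real.measurable_log.comp (measurable_pi_apply i)

theorem measurable_expMap : Measurable (expMap (d := d)) :=
  measurable_pi_iff.2 fun i => Real.measurable_exp.comp (measurable_pi_apply i)

theorem HasCubeCDF.isProbabilityMeasure_map_logMap {P : Measure (Fin d → ℝ)}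
    {F : (Fin d → ℝ) → ℝ} (hP : HasCubeCDF P F) : IsProbabilityMeasure (P.map logMap) :=
  have := hP.1
  Measure.isProbabilityMeasure_map measurable_logMap.aemeasurable

theorem HasCubeCDF.map_logMap_Iic {P : Measure (Fin d → ℝ)} {F : (Fin d → ℝ) → ℝ}
    (hP : HasCubeCDF P F) (hF : IsCopula F) {x : Fin d → ℝ} (hx : x ∈ cubeOf d (Set.Iio 0)) :
    (P.map logMap).real (Set.Iic x) = F (expMap x) := by
  rw [map_measureReal_apply measurable_logMap measurableSet_Iic, ← hP.2 (expMap x)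
    ⟨fun i => (Real.exp_pos _).le, fun i => Real.exp_le_one_iff.2 (le_of_lt (hx i))⟩]
  refine measureReal_congr ?_
  filter_upwards [hP.ae_mem_Ioo hF] with u hu
  exact propext (forall_congr' fun i => Real.log_le_iff_le_exp (hu i).1)

theorem HasCubeCDF.ae_map_logMap {P : Measure (Fin d → ℝ)} {F : (Fin d → ℝ) → ℝ}
    (hP : HasCubeCDF P F) (hF : IsCopula F) :
    ∀ᵐ x ∂(P.map logMap), x ∈ cubeOf d (Set.Iio 0) := by
  refine (ae_map_iff measurable_logMap.aemeasurable
    (isOpen_cubeOf isOpen_Iio).measurableSet).2 ?_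
  filter_upwards [hP.ae_mem_Ioo hF] with u hu
  exact fun i => Real.log_neg (hu i).1 (hu i).2

/-- Since `expMap` inverts `logMap` almost surely, total variation on the cube can be estimated in
logarithmic coordinates. -/
theorem HasCubeCDF.map_logMap_preimage_expMap {P : Measure (Fin d → ℝ)}
    {F : (Fin d → ℝ) → ℝ} (hP : HasCubeCDF P F) (hF : IsCopula F) {A : Set (Fin d → ℝ)}
    (hA : MeasurableSet A) : (P.map logMap).real (expMap ⁻¹' A) = P.real A := by
  rw [map_measureReal_apply measurable_logMap (measurable_expMap hA)]
  refine measureReal_congr ?_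
  filter_upwards [hP.ae_mem_Ioo hF] with u hu
  have : expMap (logMap u) = u := funext fun i => Real.exp_log (hu i).1
  change (expMap (logMap u) ∈ A) = (u ∈ A)
  rw [this]

end Copulas

/-! ### Scheffé's lemma and total variation bounds from densities. -/

section TotalVariation

/-- Scheffé's lemma. -/
theorem tendsto_integral_abs_sub_of_tendsto_ae {α : Type*} [MeasurableSpace α] {μ : Measure α}
    {f : ℕ → α → ℝ} {g : α → ℝ} (hf : ∀ᶠ n in atTop, Integrable (f n) μ ∧ 0 ≤ f n ∧
      ∫ x, f n x ∂μ = ∫ x, g x ∂μ) (hg : Integrable g μ) (hg0 : 0 ≤ g)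
    (hlim : ∀ᵐ x ∂μ, Tendsto (fun n => f n x) atTop (𝓝 (g x))) :
    Tendsto (fun n => ∫ x, |f n x - g x| ∂μ) atTop (𝓝 0) := by
  -- Only the positive part of g - f_n is dominated, by g. It is enough: |f_n - g| is twice this
  -- part plus f_n - g, and the latter integrates to zero.
  have h1 : Tendsto (fun n => ∫ x, max (g x - f n x) 0 ∂μ) atTop (𝓝 (∫ _, (0 : ℝ) ∂μ)) := by
    refine tendsto_integral_filter_of_dominated_convergence g ?_ ?_ hg ?_
    · filter_upwards [hf] with n hn
      exact ((hg.sub hn.1).sup (integrable_zero _ _ _)).aestronglyMeasurable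
    · filter_upwards [hf] with n hn
      refine Eventually.of_forall fun x => ?_
      have := hn.2.1 x
      simp only [Pi.zero_apply] at this
      rw [Real.norm_of_nonneg (le_max_right _ _)]
      exact max_le (by linarith) (hg0 x)
    · filter_upwards [hlim] with x hx
      have := (hx.const_sub (g x)).max (tendsto_const_nhds (x := (0 : ℝ)))
      simpa using this
  have h2 := h1.const_mul 2
  rw [integral_zero, mul_zero] at h2
  refine h2.congr' ?_
  filter_upwards [hf] with n hn
  have hi : Integrable (fun x => max (g x - f n x) 0) μ :=
    (hg.sub hn.1).sup (integrable_zero _ _ _)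
  have e : ∀ x, |f n x - g x| = 2 * max (g x - f n x) 0 + (f n x - g x) := by
    intro x
    rcases le_total (f n x) (g x) with h | h
    · rw [abs_of_nonpos (by linarith), max_eq_left (by linarith)]; ring
    · rw [abs_of_nonneg (by linarith), max_eq_right (by linarith)]; ring
  simp only [e]
  have hs : Integrable (fun x => f n x - g x) μ := hn.1.sub hg
  rw [integral_add (hi.const_mul 2) hs, integral_const_mul, integral_sub hn.1 hg,
    hn.2.2, sub_self, add_zero]

theorem integrable_of_withDensity {α : Type*} [MeasurableSpace α] {μ : Measure α} {f : α → ℝ}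
    (hf : Measurable f) (hf0 : 0 ≤ f)
    (h : IsFiniteMeasure (μ.withDensity fun x => ENNReal.ofReal (f x))) : Integrable f μ := by
  refine ⟨hf.aestronglyMeasurable, ?_⟩
  rw [hasFiniteIntegral_iff_ofReal (Eventually.of_forall hf0)]
  have := measure_lt_top (μ.withDensity fun x => ENNReal.ofReal (f x)) Set.univ
  rwa [withDensity_apply _ MeasurableSet.univ, setLIntegral_univ] at this

theorem measureReal_withDensity_ofReal {α : Type*} [MeasurableSpace α] {μ : Measure α}
    {f : α → ℝ} (hf : Integrable f μ) (hf0 : 0 ≤ f) {B : Set α} (hB : MeasurableSet B) :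
    (μ.withDensity fun x => ENNReal.ofReal (f x)).real B = ∫ x in B, f x ∂μ := by
  rw [measureReal_def, withDensity_apply _ hB,
    ← ofReal_integral_eq_lintegral_ofReal hf.integrableOn (Eventually.of_forall hf0),
    ENNReal.toReal_ofReal (integral_nonneg hf0)]

theorem abs_measureReal_withDensity_sub_le {α : Type*} [MeasurableSpace α] {μ : Measure α}
    {f g : α → ℝ} (hf : Integrable f μ) (hf0 : 0 ≤ f) (hg : Integrable g μ) (hg0 : 0 ≤ g)
    {B : Set α} (hB : MeasurableSet B) :
    |(μ.withDensity fun x => ENNReal.ofReal (f x)).real B -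
      (μ.withDensity fun x => ENNReal.ofReal (g x)).real B| ≤ ∫ x, |f x - g x| ∂μ := by
  rw [measureReal_withDensity_ofReal hf hf0 hB, measureReal_withDensity_ofReal hg hg0 hB,
    ← integral_sub hf.integrableOn hg.integrableOn]
  exact abs_integral_le_integral_abs.trans
    (setIntegral_le_integral (hf.sub hg).abs (Eventually.of_forall fun _ => abs_nonneg _))

/-! ### The change of variables x ↦ n(exp(x/n) - 1) and its L¹ continuity. -/

variable {d : ℕ}

/-- The transformation `x ↦ n (e^{x / n} - 1)` in every coordinate. -/
noncomputable def expScale (n : ℕ) (x : Fin d → ℝ) : Fin d → ℝ :=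
  fun i => n * (Real.exp (x i / n) - 1)

/-- The Jacobian determinant of `expScale n`. -/
noncomputable def expScaleJac (n : ℕ) (x : Fin d → ℝ) : ℝ := ∏ i, Real.exp (x i / n)

theorem expScaleJac_pos (n : ℕ) (x : Fin d → ℝ) : 0 < expScaleJac n x :=
  Finset.prod_pos fun _ _ => Real.exp_pos _

theorem continuous_expScale (n : ℕ) : Continuous (expScale (d := d) n) := by
  unfold expScale
  fun_prop

theorem continuous_expScaleJac (n : ℕ) : Continuous (expScaleJac (d := d) n) := by
  unfold expScaleJac
  fun_prop

theorem injective_expScale {n : ℕ} (hn : n ≠ 0) : Function.Injective (expScale (d := d) n) := by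
  intro x y h
  have hn' : (n : ℝ) ≠ 0 := by exact_mod_cast hn
  funext i
  have := congrFun h i
  simp only [expScale, mul_eq_mul_left_iff, sub_left_inj, Real.exp_eq_exp, hn', or_false] at this
  field_simp at this
  exact this

theorem hasFDerivAt_expScale {n : ℕ} (hn : n ≠ 0) (x : Fin d → ℝ) :
    HasFDerivAt (expScale n) (ContinuousLinearMap.pi fun i =>
      Real.exp (x i / n) • ContinuousLinearMap.proj (R := ℝ) (φ := fun _ : Fin d => ℝ) i) x := by
  have hn' : (n : ℝ) ≠ 0 := by exact_mod_cast hn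
  refine hasFDerivAt_pi.2 fun i => ?_
  have h1 : HasDerivAt (fun t : ℝ => (n : ℝ) * (Real.exp (t / n) - 1)) (Real.exp (x i / n))
      (x i) := by
    have := (((hasDerivAt_id (x i)).div_const (n : ℝ)).exp.sub_const 1).const_mul (n : ℝ)
    refine this.congr_deriv ?_
    simp only [id]
    field_simp
  exact HasDerivAt.comp_hasFDerivAt (h₂ := fun t : ℝ => (n : ℝ) * (Real.exp (t / n) - 1))
    (f := fun x : Fin d → ℝ => x i) x h1 (hasFDerivAt_apply i x)

theorem det_pi_smul_proj (c : Fin d → ℝ) :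
    (ContinuousLinearMap.pi fun i =>
      c i • ContinuousLinearMap.proj (R := ℝ) (φ := fun _ : Fin d => ℝ) i).det = ∏ i, c i := by
  rw [ContinuousLinearMap.det, ← LinearMap.det_toMatrix', ← Matrix.det_diagonal]
  congr 1
  ext i j
  simp [LinearMap.toMatrix'_apply, Matrix.diagonal_apply, Pi.single_apply]

theorem withDensity_of_map_expScale {n : ℕ} (hn : n ≠ 0) {ρ : Measure (Fin d → ℝ)}
    {g : (Fin d → ℝ) → ℝ}
    (h : ρ.map (expScale n) = volume.withDensity fun x => ENNReal.ofReal (g x)) :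
    ρ = volume.withDensity fun x => ENNReal.ofReal (expScaleJac n x * g (expScale n x)) := by
  ext B hB
  have hinj := injective_expScale (d := d) hn
  have him : MeasurableSet (expScale n '' B) :=
    hB.image_of_measurable_injOn (continuous_expScale n).measurable hinj.injOn
  have h1 : ρ B = (ρ.map (expScale n)) (expScale n '' B) := by
    rw [Measure.map_apply (continuous_expScale n).measurable him,
      Set.preimage_image_eq _ hinj]
  rw [h1, h, withDensity_apply _ him, withDensity_apply _ hB,
    lintegral_image_eq_lintegral_abs_det_fderiv_mul volume hB
      (fun x _ => (hasFDerivAt_expScale hn x).hasFDerivWithinAt) hinj.injOn]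
  refine lintegral_congr fun x => ?_
  rw [det_pi_smul_proj, ← expScaleJac, abs_of_pos (expScaleJac_pos n x),
    ENNReal.ofReal_mul (expScaleJac_pos n x).le]

theorem integrable_comp_expScale {n : ℕ} (hn : n ≠ 0) {f : (Fin d → ℝ) → ℝ}
    (hf : Integrable f) : Integrable fun x => expScaleJac n x * f (expScale n x) := by
  have := (integrableOn_image_iff_integrableOn_abs_det_fderiv_smul volume MeasurableSet.univ
    (fun x _ => (hasFDerivAt_expScale hn x).hasFDerivWithinAt)
    (injective_expScale (d := d) hn).injOn f).1 hf.integrableOn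
  rw [integrableOn_univ] at this
  refine this.congr (Eventually.of_forall fun x => ?_)
  simp only [smul_eq_mul]
  rw [det_pi_smul_proj, ← expScaleJac, abs_of_pos (expScaleJac_pos n x)]

/-- For n > 0 the image of `expScale n` is (-n,∞)^d, so the mass of f outside it is lost. The map f
↦ J_n · (f ∘ T_n) is therefore an L¹ contraction, uniformly in n. -/
theorem integral_comp_expScale_le {n : ℕ} (hn : n ≠ 0) {f : (Fin d → ℝ) → ℝ}
    (hf : Integrable f) (hf0 : 0 ≤ f) :
    ∫ x, expScaleJac n x * f (expScale n x) ≤ ∫ x, f x := by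
  have h := integral_image_eq_integral_abs_det_fderiv_smul volume MeasurableSet.univ
    (fun x _ => (hasFDerivAt_expScale hn x).hasFDerivWithinAt)
    (injective_expScale (d := d) hn).injOn f
  rw [setIntegral_univ] at h
  refine (le_of_eq ?_).trans (setIntegral_le_integral (s := expScale n '' Set.univ) hf
    (Eventually.of_forall hf0))
  rw [h]
  refine integral_congr_ae (Eventually.of_forall fun x => ?_)
  simp only [smul_eq_mul]
  rw [det_pi_smul_proj, ← expScaleJac, abs_of_pos (expScaleJac_pos n x)]

theorem tendsto_nat_mul_exp_div_sub_one (x : ℝ) :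
    Tendsto (fun n : ℕ => (n : ℝ) * (Real.exp (x / n) - 1)) atTop (𝓝 x) := by
  have h0 : Tendsto (fun n : ℕ => x / (n : ℝ)) atTop (𝓝 0) :=
    tendsto_const_div_atTop_nhds_zero_nat x
  rw [tendsto_iff_dist_tendsto_zero]
  -- The bound |exp s - 1 - s| ≤ s² for |s| ≤ 1 is used at s = x/n and multiplied by n.
  refine squeeze_zero' (g := fun n : ℕ => x ^ 2 / n) (Eventually.of_forall fun _ => dist_nonneg) ?_
    (tendsto_const_div_atTop_nhds_zero_nat _)
  have h1 : ∀ᶠ n : ℕ in atTop, |x / (n : ℝ)| ≤ 1 := by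
    have := h0.abs
    rw [abs_zero] at this
    exact (this.eventually_lt_const zero_lt_one).mono fun _ h => h.le
  filter_upwards [h1, eventually_gt_atTop 0] with n hn hn0
  have hn' : (0 : ℝ) < n := by exact_mod_cast hn0
  have e : (n : ℝ) * (Real.exp (x / n) - 1) - x = n * (Real.exp (x / n) - 1 - x / n) := by
    field_simp
  rw [Real.dist_eq, e, abs_mul, abs_of_pos hn']
  refine (mul_le_mul_of_nonneg_left (Real.abs_exp_sub_one_sub_id_le hn) hn'.le).trans_eq ?_
  field_simp

/-- For large n the preimage of [-M, M] lies in [-2M, 2M], which gives the functions g ∘ T_n a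
common bounded support for dominated convergence. -/
theorem abs_le_of_abs_nat_mul_exp_div_sub_one_le {n : ℕ} (hn : 0 < n) {M x : ℝ} (hM : 0 < M)
    (hnM : 2 * M ≤ n) (h : |(n : ℝ) * (Real.exp (x / n) - 1)| ≤ M) : |x| ≤ 2 * M := by
  have hn' : (0 : ℝ) < n := by exact_mod_cast hn
  obtain ⟨h1, h2⟩ := abs_le.1 h
  refine abs_le.2 ⟨?_, ?_⟩
  -- With r = M/n ≤ 1/2, the assumption makes exp(x/n)(1 - x/n) exceed (1 - r)(1 + 2r) = 1 + r(1 -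
  -- 2r) ≥ 1, yet it is at most 1.
  · by_contra! hx
    have e1 : Real.exp (x / n) * Real.exp (-(x / n)) = 1 := by rw [← Real.exp_add]; simp
    have e2 : 1 - x / n ≤ Real.exp (-(x / n)) := by
      have := Real.add_one_le_exp (-(x / n)); linarith
    have e3 : Real.exp (x / n) * (1 - x / n) ≤ 1 := by
      exact (mul_le_mul_of_nonneg_left e2 (Real.exp_pos _).le).trans_eq e1
    have e4 : 1 - M / n ≤ Real.exp (x / n) := by
      have : -(M / n) ≤ Real.exp (x / n) - 1 := by
        rw [neg_le, ← neg_le, ← neg_div, div_le_iff₀ hn']; linarith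
      linarith
    have e5 : x / n < -(2 * M) / n := (div_lt_div_iff_of_pos_right hn').2 hx
    have e6 : 1 / 2 ≤ 1 - M / n := by
      have : M / n ≤ 1 / 2 := by rw [div_le_iff₀ hn']; linarith
      linarith
    have e7 : 0 < M / n := by positivity
    have e8 : -(2 * M) / n = -(2 * (M / n)) := by ring
    rw [e8] at e5
    nlinarith
  · have := Real.add_one_le_exp (x / n)
    have e : x ≤ n * (Real.exp (x / n) - 1) := by
      calc x = n * (x / n) := by field_simp
        _ ≤ _ := mul_le_mul_of_nonneg_left (by linarith) hn'.le
    linarith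

theorem tendsto_expScale (x : Fin d → ℝ) :
    Tendsto (fun n => expScale n x) atTop (𝓝 x) :=
  tendsto_pi_nhds.2 fun i => tendsto_nat_mul_exp_div_sub_one (x i)

theorem tendsto_expScaleJac (x : Fin d → ℝ) :
    Tendsto (fun n => expScaleJac n x) atTop (𝓝 1) := by
  have : ∀ i ∈ (Finset.univ : Finset (Fin d)),
      Tendsto (fun n : ℕ => Real.exp (x i / n)) atTop (𝓝 1) := fun i _ => by
    have := (Real.continuous_exp.tendsto 0).comp (tendsto_const_div_atTop_nhds_zero_nat (x i))
    rwa [Real.exp_zero] at this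
  have h := tendsto_finsetProd _ this
  rwa [Finset.prod_const_one] at h

theorem tendsto_integral_abs_comp_expScale_sub_of_hasCompactSupport {g : (Fin d → ℝ) → ℝ}
    (hg : Continuous g) (hgs : HasCompactSupport g) :
    Tendsto (fun n => ∫ x, |expScaleJac n x * g (expScale n x) - g x|) atTop (𝓝 0) := by
  obtain ⟨K, hK⟩ := hgs.exists_bound_of_continuous hg
  obtain ⟨M, hM0, hM⟩ := hgs.isCompact.isBounded.exists_pos_norm_le
  have hK0 : 0 ≤ K := (norm_nonneg _).trans (hK 0)
  have hgM : ∀ y, g y ≠ 0 → ‖y‖ ≤ M := fun y hy => hM y (subset_tsupport g hy)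
  -- K bounds |g|, and exp(2M) bounds each of the d Jacobian factors on the ball of radius 2M once n
  -- ≥ 1.
  set c : ℝ := Real.exp (2 * M) ^ d * K + K
  have hb : Integrable ((Metric.closedBall (0 : Fin d → ℝ) (2 * M)).indicator fun _ => c) :=
    (integrable_indicator_iff Metric.isClosed_closedBall.measurableSet).2
      (integrableOn_const (measure_closedBall_lt_top.ne))
  have h := tendsto_integral_filter_of_dominated_convergence (μ := volume) (l := atTop)
    (F := fun n x => |expScaleJac n x * g (expScale n x) - g x|) (f := fun _ => (0 : ℝ)) _
    (Eventually.of_forall fun n => ?_) ?_ hb (Eventually.of_forall fun x => ?_)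
  · simpa using h
  · exact ((((continuous_expScaleJac n).mul (hg.comp (continuous_expScale n))).sub hg).abs
      ).aestronglyMeasurable
  · filter_upwards [eventually_gt_atTop 0,
      tendsto_natCast_atTop_atTop.eventually_ge_atTop (2 * M)] with n hn hnM
    have hn1 : (1 : ℝ) ≤ n := by exact_mod_cast hn
    refine Eventually.of_forall fun x => ?_
    rw [Real.norm_of_nonneg (abs_nonneg _)]
    by_cases hx : x ∈ Metric.closedBall (0 : Fin d → ℝ) (2 * M)
    · rw [Set.indicator_of_mem hx]
      have hJ : expScaleJac n x ≤ Real.exp (2 * M) ^ d := by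
        refine (Finset.prod_le_prod (g := fun _ => Real.exp (2 * M))
          (fun i _ => (Real.exp_pos _).le) fun i _ => ?_).trans_eq (by simp)
        rw [Real.exp_le_exp]
        have h1 : |x i| ≤ 2 * M := (norm_le_pi_norm x i).trans (by simpa using hx)
        exact (div_le_div_of_nonneg_right (le_abs_self _) (by linarith)).trans
          ((div_le_self (abs_nonneg _) hn1).trans h1)
      refine (norm_sub_le (expScaleJac n x * g (expScale n x)) (g x)).trans
        (add_le_add ?_ (hK x))
      rw [norm_mul, Real.norm_of_nonneg (expScaleJac_pos n x).le]
      gcongr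
      exact hK _
    · have hx' : 2 * M < ‖x‖ := by simpa using hx
      have e1 : g x = 0 := by
        by_contra hne
        have := hgM x hne
        linarith
      have e2 : g (expScale n x) = 0 := by
        by_contra hne
        have h1 := hgM _ hne
        refine absurd hx' (not_lt.2 ((pi_norm_le_iff_of_nonneg (by positivity)).2 fun i => ?_))
        exact abs_le_of_abs_nat_mul_exp_div_sub_one_le hn hM0 hnM
          ((norm_le_pi_norm (expScale n x) i).trans h1)
      simp [e1, e2, Set.indicator_of_notMem hx]
  · have h1 := (tendsto_expScaleJac x).mul ((hg.tendsto x).comp (tendsto_expScale x))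
    have h2 := (h1.sub_const (g x)).abs
    simpa using h2

/-- Density of continuous compactly supported functions in L¹ and the uniform contraction
`integral_comp_expScale_le` reduce this to the previous case, with ε/3 for each error. -/
theorem tendsto_integral_abs_comp_expScale_sub {f : (Fin d → ℝ) → ℝ} (hf : Integrable f) :
    Tendsto (fun n => ∫ x, |expScaleJac n x * f (expScale n x) - f x|) atTop (𝓝 0) := by
  rw [Metric.tendsto_atTop']
  intro ε hε
  obtain ⟨g, hgs, hfg, hg, hgi⟩ :=
    hf.exists_hasCompactSupport_integral_sub_le (ε := ε / 3) (by positivity)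
  have h := (tendsto_integral_abs_comp_expScale_sub_of_hasCompactSupport hg hgs).eventually_lt_const
    (u := ε / 3) (by positivity)
  obtain ⟨n₀, hn₀⟩ := eventually_atTop.1 h
  refine ⟨n₀, fun n hn => ?_⟩
  have hn0 : n ≠ 0 := by omega
  have hlt := hn₀ n hn.le
  have hd : Integrable fun x => |f x - g x| := (hf.sub hgi).abs
  have i1 := integrable_comp_expScale hn0 hd
  have i2 : Integrable fun x => |expScaleJac n x * g (expScale n x) - g x| :=
    ((integrable_comp_expScale hn0 hgi).sub hgi).abs
  have i3 : Integrable fun x => |expScaleJac n x * f (expScale n x) - f x| :=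
    ((integrable_comp_expScale hn0 hf).sub hf).abs
  have h1 := integral_comp_expScale_le hn0 hd fun _ => abs_nonneg _
  have h2 : ∫ x, |expScaleJac n x * f (expScale n x) - f x| ≤
      ∫ x, (expScaleJac n x * |f (expScale n x) - g (expScale n x)| +
        |expScaleJac n x * g (expScale n x) - g x| + |f x - g x|) := by
    refine integral_mono i3 ((i1.add i2).add hd) fun x => ?_
    have hJ := expScaleJac_pos n x
    dsimp only
    rw [← abs_of_pos hJ, ← abs_mul, abs_of_pos hJ]
    have e : expScaleJac n x * f (expScale n x) - f x =
        expScaleJac n x * (f (expScale n x) - g (expScale n x)) +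
        (expScaleJac n x * g (expScale n x) - g x) + (g x - f x) := by ring
    rw [e, abs_sub_comm (f x)]
    exact abs_add_three _ _ _
  have e1 := integral_add (i1.add i2) hd
  simp only [Pi.add_apply] at e1
  rw [e1, integral_add i1 i2] at h2
  simp only [Real.norm_eq_abs] at hfg
  rw [Real.dist_eq, sub_zero, abs_of_nonneg (integral_nonneg fun _ => abs_nonneg _)]
  linarith

end TotalVariation

/-! ### Rescaled maxima, the limit law and convergence in total variation. -/

section Maxima

variable {d : ℕ} {C N : (Fin d → ℝ) → ℝ}

/-- The rescaled copula `y ↦ n (C(1 + y / n) - 1)`. -/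
noncomputable def scaledCopula (C : (Fin d → ℝ) → ℝ) (n : ℕ) (y : Fin d → ℝ) : ℝ :=
  (n : ℝ) * (C (fun i => 1 + y i / n) - 1)

theorem powDeriv_zero_scaledCopula {n : ℕ} (hn : n ≠ 0) (y : Fin d → ℝ) :
    powDeriv n 0 (scaledCopula C n y) = C (fun i => 1 + y i / n) ^ n := by
  have hn' : (n : ℝ) ≠ 0 := by exact_mod_cast hn
  have e : 1 + scaledCopula C n y / n = C (fun i => 1 + y i / n) := by
    unfold scaledCopula
    field_simp
    ring
  simp [powDeriv, e]

theorem eventually_mem_cubeOf_Ioo {x : Fin d → ℝ} (hx : x ∈ cubeOf d (Set.Iio 0)) :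
    ∀ᶠ n : ℕ in atTop, x ∈ cubeOf d (Set.Ioo (-(n : ℝ)) 0) := by
  refine eventually_all.2 fun i => ?_
  filter_upwards [tendsto_natCast_atTop_atTop.eventually_gt_atTop (-x i)] with n hn
  exact ⟨by linarith, hx i⟩

theorem one_add_div_mem_Ioo {n : ℕ} {t : ℝ} (ht : t ∈ Set.Ioo (-(n : ℝ)) 0) :
    1 + t / n ∈ Set.Ioo (0 : ℝ) 1 := by
  have hn : (0 : ℝ) < n := by linarith [ht.1, ht.2]
  constructor
  · have : -1 < t / n := by rw [lt_div_iff₀ hn]; linarith [ht.1]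
    linarith
  · have := div_neg_of_neg_of_pos ht.2 hn
    linarith

/-- Convergence of the values themselves, which `MixedPartialsConverge` leaves out by requiring
nonempty blocks. Homogeneity gives n N(-x/n) = N x, and the error n · o(‖x‖/n) tends to zero. -/
theorem tendsto_scaledCopula (hN : IsDNorm N) (h_exp : HasDNormExpansion C N) {x : Fin d → ℝ}
    (hx : x ∈ cubeOf d (Set.Iio 0)) :
    Tendsto (fun n => scaledCopula C n x) atTop (𝓝 (-N x)) := by
  have hu : Tendsto (fun (n : ℕ) (i : Fin d) => 1 + x i / (n : ℝ)) atTop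
      (𝓝[Set.Icc (0 : Fin d → ℝ) 1] 1) := by
    refine tendsto_nhdsWithin_iff.2 ⟨tendsto_pi_nhds.2 fun i => ?_, ?_⟩
    · simpa using (tendsto_const_div_atTop_nhds_zero_nat (x i)).const_add 1
    · filter_upwards [eventually_mem_cubeOf_Ioo hx] with n hn
      exact ⟨fun i => (one_add_div_mem_Ioo (hn i)).1.le, fun i => (one_add_div_mem_Ioo (hn i)).2.le⟩
  have h1 := (h_exp.comp_tendsto hu).norm_right
  have h2 := (isBigO_refl (fun n : ℕ => (n : ℝ)) atTop).mul_isLittleO h1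
  have hsub : ∀ n : ℕ, (1 : Fin d → ℝ) - (fun i => 1 + x i / (n : ℝ)) = (1 / (n : ℝ)) • (-x) := by
    intro n
    funext i
    simp only [Pi.sub_apply, Pi.one_apply, Pi.smul_apply, Pi.neg_apply, smul_eq_mul]
    ring
  have h3 : (fun n : ℕ => scaledCopula C n x - -N x) =o[atTop] fun _ : ℕ => (1 : ℝ) := by
    have hO : (fun n : ℕ => (n : ℝ) * ‖(1 : Fin d → ℝ) - fun i => 1 + x i / (n : ℝ)‖) =O[atTop]
        fun _ : ℕ => (1 : ℝ) := by
      refine (isBigO_const_const ‖x‖ one_ne_zero atTop).congr' ?_ EventuallyEq.rfl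
      filter_upwards [eventually_gt_atTop 0] with n hn
      have hn' : (0 : ℝ) < n := by exact_mod_cast hn
      rw [hsub, norm_smul, norm_neg, Real.norm_of_nonneg (by positivity)]
      field_simp
    refine (h2.trans_isBigO hO).congr' ?_ EventuallyEq.rfl
    filter_upwards [eventually_gt_atTop 0] with n hn
    have hn' : (0 : ℝ) < n := by exact_mod_cast hn
    simp only [Function.comp_apply]
    rw [hsub, hN.smul (by positivity), hN.apply_neg, scaledCopula]
    field_simp
    ring
  have h4 := (isLittleO_one_iff ℝ).1 h3
  simpa using h4.add_const (-N x)

theorem contDiffOn_scaledCopula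
    (hC_diff : ContDiffOn ℝ d C {u | ∀ i, u i ∈ Set.Ioo (0 : ℝ) 1}) (n : ℕ) :
    ContDiffOn ℝ d (scaledCopula C n) (cubeOf d (Set.Ioo (-(n : ℝ)) 0)) := by
  refine contDiffOn_const.mul (ContDiffOn.sub ?_ contDiffOn_const)
  refine hC_diff.comp (ContDiff.contDiffOn ?_) fun y hy i => one_add_div_mem_Ioo (hy i)
  exact contDiff_pi.2 fun i => contDiff_const.add ((contDiff_apply ℝ ℝ i).div_const _)

theorem measurable_indicator_of_continuousOn {U : Set (Fin d → ℝ)} (hU : IsOpen U)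
    {f : (Fin d → ℝ) → ℝ} (hf : ContinuousOn f U) : Measurable (U.indicator f) := by
  classical
  rw [← Set.piecewise_eq_indicator]
  exact hf.measurable_piecewise continuousOn_const hU.measurableSet

/-- The law of the rescaled vector of maxima has distribution function `y ↦ C(1 + y / n) ^ n`. -/
theorem map_expScale_Iic (hC : IsCopula C) {n : ℕ} (hn : 1 ≤ n) {P : Measure (Fin d → ℝ)}
    (hP : HasCubeCDF P (maxCopula C n)) {y : Fin d → ℝ}
    (hy : y ∈ cubeOf d (Set.Ioo (-(n : ℝ)) 0)) :
    powDeriv n 0 (scaledCopula C n y) =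
      ((P.map logMap).map (expScale n)).real (Set.Iic y) := by
  have hn0 : n ≠ 0 := by omega
  have hn' : (0 : ℝ) < n := by exact_mod_cast hn
  have hpos : ∀ i, 0 < 1 + y i / n := fun i => (one_add_div_mem_Ioo (hy i)).1
  have hx : (fun i => (n : ℝ) * Real.log (1 + y i / n)) ∈ cubeOf d (Set.Iio 0) := fun i =>
    mul_neg_of_pos_of_neg hn' (Real.log_neg (hpos i) (one_add_div_mem_Ioo (hy i)).2)
  have hset : expScale n ⁻¹' Set.Iic y =
      Set.Iic fun i => (n : ℝ) * Real.log (1 + y i / n) := by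
    ext x
    refine forall_congr' fun i => ?_
    change (n : ℝ) * (Real.exp (x i / n) - 1) ≤ y i ↔ x i ≤ n * Real.log (1 + y i / n)
    rw [← div_le_iff₀' hn', Real.le_log_iff_exp_le (hpos i), ← le_div_iff₀' hn',
      sub_le_iff_le_add']
  rw [map_measureReal_apply (continuous_expScale n).measurable measurableSet_Iic, hset,
    hP.map_logMap_Iic (isCopula_maxCopula hC hn) hx, powDeriv_zero_scaledCopula hn0, maxCopula]
  congr 2
  funext i
  rw [expMap, ← Real.exp_mul]
  have e : (n : ℝ) * Real.log (1 + y i / n) * (1 / (n : ℝ)) = Real.log (1 + y i / n) := by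
    rw [mul_one_div, mul_div_cancel_left₀ _ hn'.ne']
  rw [e, Real.exp_log (hpos i)]

theorem hasMixedPartialsOn_powDeriv_scaledCopula
    (hC_diff : ContDiffOn ℝ d C {u | ∀ i, u i ∈ Set.Ioo (0 : ℝ) 1}) {n : ℕ} (hn : 1 ≤ n) :
    HasMixedPartialsOn (fun y => powDeriv n 0 (scaledCopula C n y))
      (cubeOf d (Set.Ioo (-(n : ℝ)) 0)) :=
  (ContDiffOn.hasMixedPartialsOn (isOpen_cubeOf isOpen_Ioo)
    (contDiffOn_scaledCopula hC_diff n)).comp (fun k t => hasDerivAt_powDeriv (by omega) k t)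
    (isOpen_cubeOf isOpen_Ioo)

theorem measurable_indicator_powDeriv_scaledCopula
    (hC_diff : ContDiffOn ℝ d C {u | ∀ i, u i ∈ Set.Ioo (0 : ℝ) 1}) (n : ℕ) :
    Measurable ((cubeOf d (Set.Ioo (-(n : ℝ)) 0)).indicator
      fun y => powDeriv n 0 (scaledCopula C n y)) := by
  refine measurable_indicator_of_continuousOn (isOpen_cubeOf isOpen_Ioo) ?_
  have h := (contDiffOn_scaledCopula hC_diff n).continuousOn
  unfold powDeriv
  fun_prop

/-- For x < 0 the number n(exp(x/n) - 1) lies in (-n, 0), so the law is carried by the open cube on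
which its distribution function is differentiated. -/
theorem map_expScale_eq_withDensity (hC : IsCopula C)
    (hC_diff : ContDiffOn ℝ d C {u | ∀ i, u i ∈ Set.Ioo (0 : ℝ) 1}) {n : ℕ} (hn : 1 ≤ n)
    {P : Measure (Fin d → ℝ)} (hP : HasCubeCDF P (maxCopula C n)) :
    (P.map logMap).map (expScale n) = volume.withDensity fun x => ENNReal.ofReal
      (partialDensity (Set.Ioo (-(n : ℝ)) 0) (fun y => powDeriv n 0 (scaledCopula C n y)) x) := by
  have hn' : (0 : ℝ) < n := by exact_mod_cast hn
  have := hP.isProbabilityMeasure_map_logMap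
  have : IsProbabilityMeasure ((P.map logMap).map (expScale n)) :=
    Measure.isProbabilityMeasure_map (continuous_expScale n).measurable.aemeasurable
  rw [← restrict_eq_withDensity_partialDensity _ isOpen_Ioo Set.ordConnected_Ioo
    (fun y hy => map_expScale_Iic hC hn hP hy)
    (measurable_indicator_powDeriv_scaledCopula hC_diff n)
    (hasMixedPartialsOn_powDeriv_scaledCopula hC_diff hn)]
  refine (Measure.restrict_eq_self_of_ae_mem ?_).symm
  refine (ae_map_iff (continuous_expScale n).measurable.aemeasurable
    (isOpen_cubeOf isOpen_Ioo).measurableSet).2 ?_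
  filter_upwards [hP.ae_map_logMap (isCopula_maxCopula hC hn)] with x hx i
  have h1 : Real.exp (x i / n) < 1 := Real.exp_lt_one_iff.2 (div_neg_of_neg_of_pos (hx i) hn')
  have h2 := Real.exp_pos (x i / n)
  constructor <;> simp only [expScale] <;> nlinarith

theorem tendsto_powDeriv_scaledCopula (hN : IsDNorm N) (h_exp : HasDNormExpansion C N)
    {x : Fin d → ℝ} (hx : x ∈ cubeOf d (Set.Iio 0)) (k : ℕ) :
    Tendsto (fun n => powDeriv n k (scaledCopula C n x)) atTop (𝓝 (Real.exp (-N x))) :=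
  tendsto_powDeriv (tendsto_scaledCopula hN h_exp hx) k

/-- Nonnegative box differences survive pointwise limits, and exp(-N) is the pointwise limit of the
distribution functions of the rescaled maxima. This is available before C_G is known to be a copula.
-/
theorem boxIncreasing_exp_neg (hC : IsCopula C) (hN : IsDNorm N)
    (h_exp : HasDNormExpansion C N) :
    BoxIncreasing (Set.Iio 0) Finset.univ fun x => Real.exp (-N x) := by
  intro L hL hLS a ha b hb hab x hx
  have hlim := tendsto_boxDiff (H := fun n y => powDeriv n 0 (scaledCopula C n y))
    (fun y hy => tendsto_powDeriv_scaledCopula hN h_exp hy 0) ha hb L x hx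
  refine ge_of_tendsto hlim ?_
  filter_upwards [eventually_mem_cubeOf_Ioo ha, eventually_mem_cubeOf_Ioo hb,
    eventually_mem_cubeOf_Ioo hx, eventually_ge_atTop 1] with n hna hnb hnx hn
  obtain ⟨P, hP, -⟩ := isCopula_maxCopula hC hn
  have := hP.1
  have : IsFiniteMeasure ((P.map logMap).map (expScale n)) := inferInstance
  exact boxIncreasing_of_cdf _ (fun y hy => map_expScale_Iic hC hn hP hy) Finset.univ L hL hLS
    a hna b hnb hab x hnx

theorem hasMixedPartialsOn_exp_neg
    (hN_diff : HasMixedPartialsOn N {x | ∀ i, x i < 0}) :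
    HasMixedPartialsOn (fun x => Real.exp (-N x)) (cubeOf d (Set.Iio 0)) :=
  HasMixedPartialsOn.comp (Φ := fun _ => Real.exp) (fun _ t => Real.hasDerivAt_exp t)
    (isOpen_cubeOf isOpen_Iio) hN_diff.neg

theorem IsDNorm.measurable_indicator_exp_neg (hN : IsDNorm N) :
    Measurable ((cubeOf d (Set.Iio 0)).indicator fun x => Real.exp (-N x)) :=
  (Real.measurable_exp.comp hN.continuous.neg.measurable).indicator
    (isOpen_cubeOf isOpen_Iio).measurableSet

/-- Extends the formula from negative b to the boundary, by continuity of N along c_k ↑ b. The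
boundary gives the total mass (b = 0) and the margins (all but one coordinate 0). -/
theorem IsDNorm.withDensity_Iic_of_nonpos (hN : IsDNorm N)
    (hG : BoxIncreasing (Set.Iio 0) Finset.univ fun x => Real.exp (-N x))
    (hN_diff : HasMixedPartialsOn N {x | ∀ i, x i < 0}) {b : Fin d → ℝ} (hb : ∀ i, b i ≤ 0) :
    (volume.withDensity fun x => ENNReal.ofReal
      (partialDensity (Set.Iio 0) (fun x => Real.exp (-N x)) x)) (Set.Iic b) =
      ENNReal.ofReal (Real.exp (-N b)) := by
  set ν := volume.withDensity fun x => ENNReal.ofReal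
      (partialDensity (Set.Iio 0) (fun x => Real.exp (-N x)) x) with hν
  have hres : ν (Set.Iic b) = ν (Set.Iic b ∩ cubeOf d (Set.Iio 0)) := by
    conv_lhs => rw [hν, ← partialDensity_restrict isOpen_Iio]
    rw [Measure.restrict_apply measurableSet_Iic]
  set c : ℕ → Fin d → ℝ := fun k i => min (b i) (-(1 / ((k : ℝ) + 1))) with hc
  have hcneg : ∀ k, c k ∈ cubeOf d (Set.Iio 0) := fun k i =>
    lt_of_le_of_lt (min_le_right _ _) (neg_neg_of_pos (by positivity : (0 : ℝ) < 1 / ((k : ℝ) + 1)))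
  have hmono : Monotone fun k => Set.Iic (c k) := by
    intro k l hkl
    refine Set.Iic_subset_Iic.2 fun i => min_le_min le_rfl (neg_le_neg ?_)
    exact one_div_le_one_div_of_le (by positivity) (by exact_mod_cast Nat.succ_le_succ hkl)
  have hlimc : Tendsto c atTop (𝓝 b) := by
    refine tendsto_pi_nhds.2 fun i => ?_
    have h := (tendsto_const_nhds (x := b i)).min
      (tendsto_one_div_add_atTop_nhds_zero_nat (𝕜 := ℝ)).neg
    rwa [neg_zero, min_eq_left (hb i)] at h
  have hU : ⋃ k, Set.Iic (c k) = Set.Iic b ∩ cubeOf d (Set.Iio 0) := by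
    ext x
    simp only [Set.mem_iUnion, Set.mem_inter_iff, Set.mem_Iic]
    constructor
    · rintro ⟨k, hk⟩
      exact ⟨fun i => (hk i).trans (min_le_left _ _), fun i => (hk i).trans_lt (hcneg k i)⟩
    · rintro ⟨h1, h2⟩
      have h3 : ∀ i, ∀ᶠ k : ℕ in atTop, 1 / ((k : ℝ) + 1) < -x i := fun i =>
        (tendsto_one_div_add_atTop_nhds_zero_nat (𝕜 := ℝ)).eventually_lt_const
          (neg_pos.2 (h2 i))
      obtain ⟨k, hk⟩ := (eventually_all.2 h3).exists
      exact ⟨k, fun i => le_min (h1 i) (by linarith [hk i])⟩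
  have t1 := tendsto_measure_iUnion_atTop (μ := ν) hmono
  rw [hU] at t1
  rw [hres]
  refine tendsto_nhds_unique t1 ?_
  have hle : ∀ x ∈ cubeOf d (Set.Iio 0), ∀ i, Real.exp (-N x) ≤ Real.exp (x i) := by
    intro x _ i
    have h1 := hN.abs_le x i
    have h2 := neg_abs_le (x i)
    exact Real.exp_le_exp.2 (by linarith)
  have hval : ∀ k, ν (Set.Iic (c k)) = ENNReal.ofReal (Real.exp (-N (c k))) := fun k =>
    withDensity_partialDensity_Iic hG hle hN.measurable_indicator_exp_neg
      (hasMixedPartialsOn_exp_neg hN_diff) (hcneg k)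
  refine Tendsto.congr (fun k => (hval k).symm) ?_
  exact (ENNReal.continuous_ofReal.tendsto _).comp
    (((Real.continuous_exp.comp hN.continuous.neg).tendsto b).comp hlimc)

theorem extremeValueCopula_of_pos {u : Fin d → ℝ} (hu : ∀ i, 0 < u i) :
    extremeValueCopula N u = Real.exp (-N (logMap u)) := by
  rw [extremeValueCopula, if_neg]
  · rfl
  · rintro ⟨i, hi⟩
    exact (hu i).ne' hi

/-- The law is the image under `expMap` of the measure with density the mixed derivative of exp(-N).
Its mass is exp(-N 0) = 1, and its margins are uniform because N(c e_i) = |c|. -/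
theorem isCopula_extremeValueCopula (hN : IsDNorm N)
    (hG : BoxIncreasing (Set.Iio 0) Finset.univ fun x => Real.exp (-N x))
    (hN_diff : HasMixedPartialsOn N {x | ∀ i, x i < 0}) :
    IsCopula (extremeValueCopula N) := by
  set ν := volume.withDensity fun x => ENNReal.ofReal
      (partialDensity (Set.Iio 0) (fun x => Real.exp (-N x)) x) with hν
  have hIic : ∀ b : Fin d → ℝ, (∀ i, b i ≤ 0) →
      ν (Set.Iic b) = ENNReal.ofReal (Real.exp (-N b)) := fun b hb =>
    hN.withDensity_Iic_of_nonpos hG hN_diff hb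
  have hprob : IsProbabilityMeasure ν := by
    refine ⟨?_⟩
    have h1 : ν Set.univ = ν (Set.Iic 0) := by
      have hm := (isOpen_cubeOf (d := d) (isOpen_Iio (a := (0 : ℝ)))).measurableSet
      have hsub : cubeOf d (Set.Iio 0) ⊆ Set.Iic 0 := fun x hx i => le_of_lt (hx i)
      rw [hν, ← partialDensity_restrict isOpen_Iio, Measure.restrict_apply MeasurableSet.univ,
        Measure.restrict_apply measurableSet_Iic, Set.univ_inter,
        Set.inter_eq_right.2 hsub]
    rw [h1, hIic 0 fun _ => le_rfl, hN.apply_zero]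
    simp
  refine isCopula_of_hasCubeCDF (P := ν.map expMap)
    ⟨Measure.isProbabilityMeasure_map measurable_expMap.aemeasurable, fun u hu => ?_⟩ ?_ ?_
  · rw [map_measureReal_apply measurable_expMap measurableSet_Iic]
    by_cases h : ∃ i, u i = 0
    · obtain ⟨i, hi⟩ := id h
      rw [extremeValueCopula, if_pos h]
      have : expMap ⁻¹' Set.Iic u = ∅ := by
        refine Set.eq_empty_of_forall_notMem fun x hx => ?_
        have h1 : Real.exp (x i) ≤ u i := hx i
        linarith [Real.exp_pos (x i)]
      rw [this, measureReal_empty]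
    · push Not at h
      have hpos : ∀ i, 0 < u i := fun i => lt_of_le_of_ne (hu.1 i) (h i).symm
      rw [extremeValueCopula_of_pos hpos]
      have : expMap ⁻¹' Set.Iic u = Set.Iic (logMap u) := by
        ext x
        exact forall_congr' fun i => (Real.le_log_iff_exp_le (hpos i)).symm
      rw [this, measureReal_def, hIic (logMap u) fun i => Real.log_nonpos (hu.1 i) (hu.2 i),
        ENNReal.toReal_ofReal (Real.exp_pos _).le]
  · rw [extremeValueCopula_of_pos (u := 1) fun _ => zero_lt_one,
      show logMap (1 : Fin d → ℝ) = 0 from funext fun _ => Real.log_one, hN.apply_zero]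
    simp
  · intro i t ht
    rcases ht.1.eq_or_lt with h0 | h0
    · rw [extremeValueCopula, if_pos ⟨i, by simp [← h0]⟩, h0]
    · have e : logMap (Function.update (1 : Fin d → ℝ) i t) = Pi.single i (Real.log t) := by
        funext j
        by_cases h : j = i
        · subst h; simp [logMap]
        · simp [logMap, h]
      rw [extremeValueCopula_of_pos, e, hN.apply_single,
        abs_of_nonpos (Real.log_nonpos ht.1 ht.2), neg_neg, Real.exp_log h0]
      intro j
      by_cases h : j = i
      · subst h; simpa using h0
      · simp [h]

theorem map_logMap_eq_withDensity (hN : IsDNorm N)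
    (hN_diff : HasMixedPartialsOn N {x | ∀ i, x i < 0})
    (hE : IsCopula (extremeValueCopula N)) {Q : Measure (Fin d → ℝ)}
    (hQ : HasCubeCDF Q (extremeValueCopula N)) :
    Q.map logMap = volume.withDensity fun x => ENNReal.ofReal
      (partialDensity (Set.Iio 0) (fun x => Real.exp (-N x)) x) := by
  have := hQ.isProbabilityMeasure_map_logMap
  rw [← restrict_eq_withDensity_partialDensity (Q.map logMap) isOpen_Iio Set.ordConnected_Iio
    (fun x hx => ?_) hN.measurable_indicator_exp_neg
    (hasMixedPartialsOn_exp_neg hN_diff)]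
  · exact (Measure.restrict_eq_self_of_ae_mem (hQ.ae_map_logMap hE)).symm
  · rw [hQ.map_logMap_Iic hE hx, extremeValueCopula_of_pos (u := expMap x) fun i => Real.exp_pos _]
    congr 3
    funext i
    exact (Real.log_exp _).symm

/-- The densities of the rescaled maxima converge pointwise. -/
theorem tendsto_partialDensity (hN : IsDNorm N)
    (hN_diff : HasMixedPartialsOn N {x | ∀ i, x i < 0}) (h_exp : HasDNormExpansion C N)
    (h_lim : MixedPartialsConverge C N)
    (hC_diff : ContDiffOn ℝ d C {u | ∀ i, u i ∈ Set.Ioo (0 : ℝ) 1}) (x : Fin d → ℝ) :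
    Tendsto (fun n : ℕ => partialDensity (Set.Ioo (-(n : ℝ)) 0)
      (fun y => powDeriv n 0 (scaledCopula C n y)) x) atTop
      (𝓝 (partialDensity (Set.Iio 0) (fun x => Real.exp (-N x)) x)) := by
  by_cases hx : x ∈ cubeOf d (Set.Iio 0)
  · have h := tendsto_mixedPartial_comp (Φ := powDeriv) (Φ' := fun _ => Real.exp)
      (g := scaledCopula C) (g' := fun y => -N y)
      (U := fun n : ℕ => cubeOf d (Set.Ioo (-(n : ℝ)) 0)) (U' := cubeOf d (Set.Iio 0))
      (fun n => isOpen_cubeOf isOpen_Ioo) (isOpen_cubeOf isOpen_Iio)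
      ((eventually_ne_atTop 0).mono fun n hn k t => hasDerivAt_powDeriv hn k t)
      (fun _ t => Real.hasDerivAt_exp t)
      (Eventually.of_forall fun n => ContDiffOn.hasMixedPartialsOn (isOpen_cubeOf isOpen_Ioo)
        (contDiffOn_scaledCopula hC_diff n)) hN_diff.neg
      (eventually_mem_cubeOf_Ioo hx) hx
      (tendsto_powDeriv_scaledCopula hN h_exp hx) (fun B hB => h_lim B hB x hx) Finset.univ
    rw [partialDensity, Set.indicator_of_mem hx]
    refine h.congr' ?_
    filter_upwards [eventually_mem_cubeOf_Ioo hx] with n hn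
    rw [partialDensity, Set.indicator_of_mem hn]
  · have h1 : ∀ n : ℕ, x ∉ cubeOf d (Set.Ioo (-(n : ℝ)) 0) := fun n h => hx fun i => (h i).2
    simp [partialDensity, Set.indicator_of_notMem hx, Set.indicator_of_notMem (h1 _)]

theorem tvDistCube_nonneg (P Q : Measure (Fin d → ℝ)) : 0 ≤ tvDistCube P Q :=
  Real.iSup_nonneg fun _ => abs_nonneg _

theorem tendsto_tvDistCube (hC : IsCopula C) (hN : IsDNorm N)
    (hN_diff : HasMixedPartialsOn N {x | ∀ i, x i < 0}) (h_exp : HasDNormExpansion C N)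
    (h_lim : MixedPartialsConverge C N)
    (hC_diff : ContDiffOn ℝ d C {u | ∀ i, u i ∈ Set.Ioo (0 : ℝ) 1})
    (hE : IsCopula (extremeValueCopula N)) {P : ℕ → Measure (Fin d → ℝ)}
    {Q : Measure (Fin d → ℝ)} (hP : ∀ n : ℕ, 1 ≤ n → HasCubeCDF (P n) (maxCopula C n))
    (hQ : HasCubeCDF Q (extremeValueCopula N)) :
    Tendsto (fun n => tvDistCube (P n) Q) atTop (𝓝 0) := by
  set h : (Fin d → ℝ) → ℝ := partialDensity (Set.Iio 0) fun x => Real.exp (-N x)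
  set f : ℕ → (Fin d → ℝ) → ℝ := fun n => partialDensity (Set.Ioo (-(n : ℝ)) 0)
    fun y => powDeriv n 0 (scaledCopula C n y)
  have hQd : Q.map logMap = volume.withDensity fun x => ENNReal.ofReal (h x) :=
    map_logMap_eq_withDensity hN hN_diff hE hQ
  have hQp := hQ.isProbabilityMeasure_map_logMap
  have hh0 : 0 ≤ h := partialDensity_nonneg isOpen_Iio (boxIncreasing_exp_neg hC hN h_exp)
    (hasMixedPartialsOn_exp_neg hN_diff)
  have hhi : Integrable h := integrable_of_withDensity
    (measurable_partialDensity isOpen_Iio hN.measurable_indicator_exp_neg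
      (hasMixedPartialsOn_exp_neg hN_diff)) hh0 (by rw [← hQd]; infer_instance)
  have hh1 : ∫ x, h x = 1 := by
    have := measureReal_withDensity_ofReal hhi hh0 MeasurableSet.univ
    rw [← hQd, probReal_univ, setIntegral_univ] at this
    exact this.symm
  have hfd : ∀ n, 1 ≤ n → ((P n).map logMap).map (expScale n) =
      volume.withDensity fun x => ENNReal.ofReal (f n x) := fun n hn =>
    map_expScale_eq_withDensity hC hC_diff hn (hP n hn)
  have hf : ∀ n, 1 ≤ n → Integrable (f n) ∧ 0 ≤ f n ∧ ∫ x, f n x = ∫ x, h x := by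
    intro n hn
    have := (hP n hn).isProbabilityMeasure_map_logMap
    have hp : IsProbabilityMeasure (((P n).map logMap).map (expScale n)) :=
      Measure.isProbabilityMeasure_map (continuous_expScale n).measurable.aemeasurable
    have h0 : 0 ≤ f n := partialDensity_nonneg isOpen_Ioo
      (boxIncreasing_of_cdf _ (fun y hy => map_expScale_Iic hC hn (hP n hn) hy) _)
      (hasMixedPartialsOn_powDeriv_scaledCopula hC_diff hn)
    have hi : Integrable (f n) := integrable_of_withDensity
      (measurable_partialDensity isOpen_Ioo (measurable_indicator_powDeriv_scaledCopula hC_diff n)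
        (hasMixedPartialsOn_powDeriv_scaledCopula hC_diff hn)) h0
      (by rw [← hfd n hn]; infer_instance)
    refine ⟨hi, h0, ?_⟩
    have := measureReal_withDensity_ofReal hi h0 MeasurableSet.univ
    rw [← hfd n hn, probReal_univ, setIntegral_univ] at this
    rw [hh1, this]
  have hscheffe : Tendsto (fun n => ∫ x, |f n x - h x|) atTop (𝓝 0) :=
    tendsto_integral_abs_sub_of_tendsto_ae ((eventually_ge_atTop 1).mono hf) hhi hh0
      (Eventually.of_forall fun x => tendsto_partialDensity hN hN_diff h_exp h_lim hC_diff x)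
  have hsum := hscheffe.add (tendsto_integral_abs_comp_expScale_sub hhi)
  rw [add_zero] at hsum
  refine squeeze_zero' (Eventually.of_forall fun n => tvDistCube_nonneg _ _) ?_ hsum
  filter_upwards [eventually_ge_atTop 1] with n hn
  have hn0 : n ≠ 0 := by omega
  obtain ⟨hfi, hf0, -⟩ := hf n hn
  have hd : Integrable fun x => |f n x - h x| := (hfi.sub hhi).abs
  have hk := integrable_comp_expScale hn0 hfi
  have hk0 : 0 ≤ fun x => expScaleJac n x * f n (expScale n x) := fun x =>
    mul_nonneg (expScaleJac_pos n x).le (hf0 _)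
  have hPd := withDensity_of_map_expScale hn0 (hfd n hn)
  have i1 := integrable_comp_expScale hn0 hd
  have i2 : Integrable fun x => |expScaleJac n x * h (expScale n x) - h x| :=
    ((integrable_comp_expScale hn0 hhi).sub hhi).abs
  have i3 : Integrable fun x => |expScaleJac n x * f n (expScale n x) - h x| :=
    (hk.sub hhi).abs
  refine Real.iSup_le (fun A => ?_) (add_nonneg (integral_nonneg fun _ => abs_nonneg _)
    (integral_nonneg fun _ => abs_nonneg _))
  obtain ⟨A, hA, -⟩ := A
  -- Both laws are compared in logarithmic coordinates, where each has a Lebesgue density.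
  rw [← (hP n hn).map_logMap_preimage_expMap (isCopula_maxCopula hC hn) hA,
    ← hQ.map_logMap_preimage_expMap hE hA, hPd, hQd]
  refine (abs_measureReal_withDensity_sub_le hk hk0 hhi hh0 (measurable_expMap hA)).trans ?_
  -- The intermediate function is J_n · (h ∘ T_n): the first error contracts to ‖f_n - h‖₁, and the
  -- second involves only the fixed function h.
  calc ∫ x, |expScaleJac n x * f n (expScale n x) - h x|
      ≤ ∫ x, (expScaleJac n x * |f n (expScale n x) - h (expScale n x)| +
          |expScaleJac n x * h (expScale n x) - h x|) := by
        refine integral_mono i3 (i1.add i2) fun x => ?_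
        dsimp only
        rw [← abs_of_pos (expScaleJac_pos n x), ← abs_mul, abs_of_pos (expScaleJac_pos n x),
          mul_sub]
        exact abs_sub_le _ _ _
    _ = (∫ x, expScaleJac n x * |f n (expScale n x) - h (expScale n x)|) +
          ∫ x, |expScaleJac n x * h (expScale n x) - h x| := integral_add i1 i2
    _ ≤ _ := by
        exact add_le_add_left (integral_comp_expScale_le hn0 hd fun _ => abs_nonneg _) _

end Maxima

theorem mainTheorem3 (d : ℕ) (C N : (Fin d → ℝ) → ℝ)
    (hC : IsCopula C) (hN : IsDNorm N)
    (hN_diff : HasMixedPartialsOn N {x | ∀ i, x i < 0})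
    (h_exp : HasDNormExpansion C N)
    (h_lim : MixedPartialsConverge C N)
    (hC_diff : ContDiffOn ℝ d C {u | ∀ i, u i ∈ Set.Ioo (0 : ℝ) 1}) :
    (∀ n : ℕ, 1 ≤ n → IsCopula (maxCopula C n)) ∧
    IsCopula (extremeValueCopula N) ∧
    ∀ (P : ℕ → Measure (Fin d → ℝ)) (Q : Measure (Fin d → ℝ)),
      (∀ n : ℕ, 1 ≤ n → HasCubeCDF (P n) (maxCopula C n)) →
      HasCubeCDF Q (extremeValueCopula N) →
      Tendsto (fun n => tvDistCube (P n) Q) atTop (𝓝 0) := by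
  have hE : IsCopula (extremeValueCopula N) :=
    isCopula_extremeValueCopula hN (boxIncreasing_exp_neg hC hN h_exp) hN_diff
  exact ⟨fun n hn => isCopula_maxCopula hC hn, hE, fun P Q hP hQ =>
    tendsto_tvDistCube hC hN hN_diff h_exp h_lim hC_diff hE hP hQ⟩
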